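/- Conventions. For $n\in\mathbb Z$ put $[n]_q=\frac{1-q^n}{1-q}$, and for a finite sequence of integers put $$[a_1,\dots,a_n]_q=[a_1]_q+\cfrac{q^{a_1}}{[a_2]_{q^{-1}}+\cfrac{q^{-a_2}}{[a_3]_q+\cfrac{q^{a_3}}{\ddots}}}\,,\qquad [\![c_1,\dots,c_n]\!]_q=[c_1]_q-\cfrac{q^{c_1-1}}{[c_2]_q-\cfrac{q^{c_2-1}}{\ddots}}\,,$$ where the last level of each fraction consists of its $q$-integer only (in the first fraction $q$ and $q^{-1}$ alternate). Let $[a_1,a_2,\dots]=a_1+\frac{1}{a_2+\cdots}$ and $[\![c_1,c_2,\dots]\!]=c_1-\frac{1}{c_2-\cdots}$ denote the usual regular and negative continued fractions. A rational number $y$ is written uniquely as $y=[a_1,\dots,a_{2m}]$ with $m\ge1$, $a_i\in\mathbb Z$ and $a_i\ge1$ for $i\ge2$; its $q$-deformation is $[y]_q=[a_1,\dots,a_{2m}]_q$, expanded as a Laurent series in $q$. Laurent series converge when each coefficient stabilizes. The $q$-deformation $[x]_q$ of an irrational number $x$ is the Laurent series with integer coefficients that is the limit of $[y_n]_q$ for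 every sequence $(y_n)$ of rational numbers converging to $x$. A polynomial $P\in\mathbb Z[q]$ is a palindrome if $P(q)=q^NP(q^{-1})$ for some $N\in\mathbb Z$. Theorem 1.2. Let $x=\frac{r\pm\sqrt p}{s}$ be a real quadratic irrational, where $r\in\mathbb Z$, $s,p\in\mathbb Z_{>0}$ and $p$ is not a square. Then $[x]_q$ is well defined, and the following hold. (i) $[x]_q=\frac{R\pm\sqrt P}{S}$ with $R,P,S\in\mathbb Z[q]$, $S\ne0$ and $P$ a palindrome, where $\sqrt P$ is a Laurent series with square $P$. (ii) There are $A,B,C\in\mathbb Z[q]$ with $A\neq0$ such that $A\,[x]_q^2+B\,[x]_q+C=0$. (iii) There is a matrix $M_q=\begin{pmatrix}A&B\\C&D\end{pmatrix}\in\mathrm{GL}(2,\mathbb Z[q^{\pm1}])$, not a scalar matrix, such that $C[x]_q+D\ne0$ and $\frac{A[x]_q+B}{C[x]_q+D}=[x]_q$. (iv) $[x]_q$ has periodic continued fraction expansions: there are eventually periodic sequences of integers $(a_i)_{i\ge1}$, with $a_i\ge1$ for $i\ge2$, and $(c_i)_{i\ge1}$, with $c_i\ge2$ for $i\ge2$,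 such that $x=[a_1,a_2,\dots]=[\![c_1,c_2,\dots]\!]$ and $$[x]_q=[a_1,a_2,\dots]_q=[\![c_1,c_2,\dots]\!]_q,$$ that is, $[x]_q$ is the limit of $[a_1,\dots,a_{2m}]_q$ as $m\to\infty$ and of $[\![c_1,\dots,c_n]\!]_q$ as $n\to\infty$. -/

import Mathlib

open Filter Topology Polynomial LaurentPolynomial LaurentSeries

namespace QDeformed

/-! ### Quadratic irrationals and classical continued fractions -/

/-- `x` is a real quadratic irrational number: `x = (r ± √p) / s` with `r` an integer, `s, p`
positive integers and `p` not a square. -/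
def IsQuadraticIrrational (x : ℝ) : Prop :=
  ∃ r p s : ℤ, 0 < p ∧ 0 < s ∧ ¬ IsSquare p ∧
    (x = ((r : ℝ) + √(p : ℝ)) / (s : ℝ) ∨ x = ((r : ℝ) - √(p : ℝ)) / (s : ℝ))

/-- The finite regular continued fraction `[a₁, …, aₙ] = a₁ + 1 / (a₂ + 1 / (⋯ + 1 / aₙ))`. -/
def regCF {K : Type*} [Field K] : List ℤ → K
  | [] => 0
  | [a] => (a : K)
  | a :: b :: l => (a : K) + 1 / regCF (b :: l)

/-- The finite negative continued fraction `⟦c₁, …, cₙ⟧ = c₁ - 1 / (c₂ - 1 / (⋯ - 1 / cₙ))`. -/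
def negCF {K : Type*} [Field K] : List ℤ → K
  | [] => 0
  | [c] => (c : K)
  | c :: d :: l => (c : K) - 1 / negCF (d :: l)

theorem den_inv_fract_inv_fract_lt {y : ℚ} (hy : Int.fract y ≠ 0)
    (hz : Int.fract (Int.fract y)⁻¹ ≠ 0) :
    (Int.fract (Int.fract y)⁻¹)⁻¹.den < y.den := by
  have hpos : 0 < Int.fract y := lt_of_le_of_ne (Int.fract_nonneg y) (Ne.symm hy)
  have h1 := Rat.fract_inv_num_lt_num_of_pos hpos
  have h2 : 0 < (Int.fract (Int.fract y)⁻¹).num :=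
    Rat.num_pos.mpr (lt_of_le_of_ne (Int.fract_nonneg _) (Ne.symm hz))
  have h3 : (Int.fract y).num < (Int.fract y).den := by
    have h := Int.fract_lt_one y
    rw [Rat.lt_iff] at h
    simpa using h
  have h4 : (Int.fract y).den = y.den := by
    rw [Int.fract, Rat.sub_intCast_den]
  rw [Rat.den_inv_of_ne_zero hz]
  omega

/-- The expansion `[a₁, …, a₂ₘ]` of a rational number as a regular continued fraction of even
length, with `aᵢ ≥ 1` for `i ≥ 2`. -/
def evenExpansion (y : ℚ) : List ℤ :=
  if _hy : Int.fract y = 0 then [⌊y⌋ - 1, 1]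
  else if _hz : Int.fract (Int.fract y)⁻¹ = 0 then [⌊y⌋, ⌊(Int.fract y)⁻¹⌋]
  else ⌊y⌋ :: ⌊(Int.fract y)⁻¹⌋ :: evenExpansion (Int.fract (Int.fract y)⁻¹)⁻¹
termination_by y.den
decreasing_by exact den_inv_fract_inv_fract_lt _hy _hz

theorem evenExpansion_spec (y : ℚ) :
    Even (evenExpansion y).length ∧ (∃ a b l, evenExpansion y = a :: b :: l ∧ a ≤ y) ∧
      (∀ a ∈ (evenExpansion y).tail, 1 ≤ a) ∧ (1 < y → ∀ a ∈ evenExpansion y, 1 ≤ a) ∧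
      regCF (evenExpansion y) = y := by
  induction y using evenExpansion.induct with
  | case1 y hy =>
    rw [evenExpansion, dif_pos hy]
    have h1 : (⌊y⌋ : ℚ) = y := by rw [Int.fract] at hy; linarith
    refine ⟨by simp, ⟨_, _, _, rfl, by push_cast; linarith⟩, by simp, fun h => ?_, ?_⟩
    · have h2 : (1 : ℤ) < ⌊y⌋ := by rw [← h1] at h; exact_mod_cast h
      simp only [List.mem_cons, List.not_mem_nil, or_false, forall_eq_or_imp, forall_eq]
      omega
    · simp [regCF, h1]
  | case2 y hy hz =>
    rw [evenExpansion, dif_neg hy, dif_pos hz]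
    have hpos : 0 < Int.fract y := lt_of_le_of_ne (Int.fract_nonneg y) (Ne.symm hy)
    have hb : (1 : ℤ) ≤ ⌊(Int.fract y)⁻¹⌋ :=
      Int.le_floor.mpr (by simpa using (one_le_inv₀ hpos).mpr (Int.fract_lt_one y).le)
    have h1 : (⌊(Int.fract y)⁻¹⌋ : ℚ) = (Int.fract y)⁻¹ := by
      have := Int.floor_add_fract (Int.fract y)⁻¹
      rw [hz] at this; linarith
    refine ⟨by simp, ⟨_, _, _, rfl, Int.floor_le y⟩, by simpa using hb, fun h => ?_, ?_⟩
    · have h2 : (1 : ℤ) ≤ ⌊y⌋ := Int.le_floor.mpr (by simpa using h.le)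
      simpa using ⟨h2, hb⟩
    · simp [regCF, h1]
  | case3 y hy hz ih =>
    rw [evenExpansion, dif_neg hy, dif_neg hz]
    have hpos : 0 < Int.fract y := lt_of_le_of_ne (Int.fract_nonneg y) (Ne.symm hy)
    have hb : (1 : ℤ) ≤ ⌊(Int.fract y)⁻¹⌋ :=
      Int.le_floor.mpr (by simpa using (one_le_inv₀ hpos).mpr (Int.fract_lt_one y).le)
    have hpos' : 0 < Int.fract (Int.fract y)⁻¹ :=
      lt_of_le_of_ne (Int.fract_nonneg _) (Ne.symm hz)
    have hgt : 1 < (Int.fract (Int.fract y)⁻¹)⁻¹ :=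
      (one_lt_inv₀ hpos').mpr (Int.fract_lt_one _)
    obtain ⟨ih1, ⟨a, b, l, hl, -⟩, ih3, ih4, ih5⟩ := ih
    have ih4 := ih4 hgt
    refine ⟨by simpa [Nat.even_add_one] using ih1, ⟨_, _, _, rfl, Int.floor_le y⟩, ?_,
      fun h => ?_, ?_⟩
    · simpa using ⟨hb, ih4⟩
    · have h2 : (1 : ℤ) ≤ ⌊y⌋ := Int.le_floor.mpr (by simpa using h.le)
      simpa using ⟨h2, hb, ih4⟩
    · rw [hl] at ih5 ⊢
      simp only [regCF] at ih5 ⊢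
      rw [ih5]
      simp only [one_div, inv_inv, Int.floor_add_fract]

/-! ### The `q`-deformed rational numbers -/

/-- The `q`-integer `[n]_q = (1 - q ^ n) / (1 - q)`, for every `n : ℤ` (where `q ≠ 0, 1`). -/
def qInt {K : Type*} [Field K] (q : K) (n : ℤ) : K := (1 - q ^ n) / (1 - q)

/-- The `q`-deformed regular continued fraction
`[a₁, …, aₙ]_q = [a₁]_q + q ^ a₁ / ([a₂]_{q⁻¹} + q ^ (-a₂) / ([a₃]_q + q ^ a₃ / ⋯))`:
the parameters `q` and `q⁻¹` alternate. -/
def qRegCF {K : Type*} [Field K] (q : K) : List ℤ → K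
  | [] => 0
  | [a] => qInt q a
  | a :: b :: l => qInt q a + q ^ a / qRegCF q⁻¹ (b :: l)

/-- The `q`-deformed negative continued fraction
`⟦c₁, …, cₙ⟧_q = [c₁]_q - q ^ (c₁ - 1) / ([c₂]_q - q ^ (c₂ - 1) / ⋯)`. -/
def qNegCF {K : Type*} [Field K] (q : K) : List ℤ → K
  | [] => 0
  | [c] => qInt q c
  | c :: d :: l => qInt q c - q ^ (c - 1) / qNegCF q (d :: l)

/-- The variable `q` of the field `ℚ((q))` of formal Laurent series. -/
noncomputable def qVar : ℚ⸨X⸩ := HahnSeries.single (1 : ℤ) (1 : ℚ)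

theorem qVar_ne_zero : qVar ≠ 0 := HahnSeries.single_ne_zero one_ne_zero

/-- The `q`-deformation `[y]_q` of a rational number `y`, expanded as a Laurent series. -/
noncomputable def qRat (y : ℚ) : ℚ⸨X⸩ := qRegCF qVar (evenExpansion y)

/-! ### The `q`-deformed real numbers -/

/-- Every coefficient of the Laurent series `u n` stabilizes, as `n` grows, at the
corresponding coefficient of `F`. -/
def CoeffTendsto (u : ℕ → ℚ⸨X⸩) (F : ℚ⸨X⸩) : Prop :=
  ∀ k : ℤ, ∀ᶠ n in atTop, (u n).coeff k = F.coeff k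

/-- `F` is the Laurent series with integer coefficients that is the limit of `[yₙ]_q` for every
sequence `(yₙ)` of rational numbers converging to `x`. -/
def IsQDeformation (x : ℝ) (F : ℚ⸨X⸩) : Prop :=
  (∀ k : ℤ, ∃ m : ℤ, F.coeff k = (m : ℚ)) ∧
  ∀ y : ℕ → ℚ, Tendsto (fun n => (y n : ℝ)) atTop (𝓝 x) → CoeffTendsto (fun n => qRat (y n)) F

theorem IsQDeformation.unique {x : ℝ} {F G : ℚ⸨X⸩} (hF : IsQDeformation x F)
    (hG : IsQDeformation x G) : F = G := by
  have hx : x ∈ closure (Set.range ((↑) : ℚ → ℝ)) := Rat.denseRange_cast x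
  obtain ⟨v, hv, hlim⟩ := mem_closure_iff_seq_limit.mp hx
  choose y hy using hv
  have hlim' : Tendsto (fun n => (y n : ℝ)) atTop (𝓝 x) := by
    simpa only [hy] using hlim
  ext k
  obtain ⟨n, h1, h2⟩ := ((hF.2 y hlim' k).and (hG.2 y hlim' k)).exists
  exact h1.symm.trans h2

open Classical in
/-- The `q`-deformation `[x]_q` of a real number `x`: for `x` rational it is `qRat`, and for `x`
irrational it is the limit series of `IsQDeformation` (or `0`, should there be none). -/
noncomputable def qReal (x : ℝ) : ℚ⸨X⸩ :=
  if h : ∃ y : ℚ, (y : ℝ) = x then qRat h.choose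
  else if h : ∃ F, IsQDeformation x F then h.choose
  else 0

/-! ### Polynomials, matrices and periodic expansions -/

/-- The Laurent series of a polynomial in `ℤ[q]`. -/
noncomputable def polyToSeries : ℤ[X] →+* ℚ⸨X⸩ :=
  (Polynomial.aeval (R := ℤ) qVar).toRingHom

/-- The Laurent series of a Laurent polynomial in `ℤ[q, q⁻¹]`. -/
noncomputable def laurentToSeries : ℤ[T;T⁻¹] →+* ℚ⸨X⸩ :=
  LaurentPolynomial.eval₂ (Int.castRingHom ℚ⸨X⸩) (Units.mk0 qVar qVar_ne_zero)

/-- The polynomial `P` is a palindrome: `P(q) = q ^ N P(q⁻¹)` for some integer `N`. -/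
def IsPalindrome (P : ℤ[X]) : Prop :=
  ∃ N : ℤ, Polynomial.toLaurent P = LaurentPolynomial.T N *
    LaurentPolynomial.invert (Polynomial.toLaurent P)

/-- The Möbius transformation of the matrix `M` is defined at the series `F` and fixes it:
`(A F + B) / (C F + D) = F`. -/
def MoebiusFixes (M : Matrix.GeneralLinearGroup (Fin 2) ℤ[T;T⁻¹]) (F : ℚ⸨X⸩) : Prop :=
  laurentToSeries (M.val 1 0) * F + laurentToSeries (M.val 1 1) ≠ 0 ∧
  (laurentToSeries (M.val 0 0) * F + laurentToSeries (M.val 0 1)) /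
    (laurentToSeries (M.val 1 0) * F + laurentToSeries (M.val 1 1)) = F

/-- The sequence `a` is periodic from some index on. -/
def EventuallyPeriodic (a : ℕ → ℤ) : Prop :=
  ∃ N t : ℕ, 0 < t ∧ ∀ n, N ≤ n → a (n + t) = a n

/-- The list of the first `n` terms of the sequence `a`. -/
def truncation (a : ℕ → ℤ) (n : ℕ) : List ℤ := (List.range n).map a

/-- The real number `x` has an eventually periodic expansion `x = [a₁, a₂, …]` as an infinite
regular continued fraction (`aᵢ` integers, `aᵢ ≥ 1` for `i ≥ 2`) and `F = [a₁, a₂, …]_q`, that is,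
`F` is the limit of `[a₁, …, a₂ₘ]_q`. The term `aᵢ` is `a (i - 1)`. -/
def HasPeriodicRegExpansion (x : ℝ) (F : ℚ⸨X⸩) : Prop :=
  ∃ a : ℕ → ℤ, (∀ i, 1 ≤ i → 1 ≤ a i) ∧ EventuallyPeriodic a ∧
    Tendsto (fun n => (regCF (truncation a n) : ℝ)) atTop (𝓝 x) ∧
    CoeffTendsto (fun m => qRegCF qVar (truncation a (2 * m))) F

/-- The real number `x` has an eventually periodic expansion `x = ⟦c₁, c₂, …⟧` as an infinite
negative continued fraction (`cᵢ` integers, `cᵢ ≥ 2` for `i ≥ 2`) and `F = ⟦c₁, c₂, …⟧_q`, that is,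
`F` is the limit of `⟦c₁, …, cₙ⟧_q`. The term `cᵢ` is `c (i - 1)`. -/
def HasPeriodicNegExpansion (x : ℝ) (F : ℚ⸨X⸩) : Prop :=
  ∃ c : ℕ → ℤ, (∀ i, 1 ≤ i → 2 ≤ c i) ∧ EventuallyPeriodic c ∧
    Tendsto (fun n => (negCF (truncation c n) : ℝ)) atTop (𝓝 x) ∧
    CoeffTendsto (fun n => qNegCF qVar (truncation c n)) F

end QDeformed

/-! Two levels of the `q`-fraction form the Möbius map `qStep q a b`, of determinant `q^(a+b)`. On
one-units, the series in `1 + qℤ⟦q⟧`, its denominator is again a one-unit, so for `a, b ≥ 1` it is a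
`q`-adic contraction preserving one-units. Hence the digits of an irrational `x` define a series `f
x` with `f x = qStep q ⌊x⌋ ⌊gauss x⌋ (f (gauss (gauss x)))` (`exists_isRegSeries`). A rational close
to `x` shares its first digits, so `f x` is the limit required of `[x]_q`
(`IsRegSeries.isQDeformation`).

For quadratic `x` the orbit under `gauss` is eventually periodic (Lagrange). The matrix of an even
period, conjugated by that of a preperiod, fixes `f x` projectively. At `q = 1` it becomes a
classical matrix fixing `x`, whose lower left entry is nonzero (`fixingMatrix_lower_left_ne_zero`);
so the fixed point equation is truly quadratic and the matrix is not scalar.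

The discriminant of that equation is `tr² - 4 det`. The generators `genR` and `genL` are intertwined
by one common matrix with `q` times their images under `q ↦ q⁻¹`. Hence a product of digit matrices
with determinant `q^n` has trace satisfying `tr(q) = q^n tr(q⁻¹)`, which makes the discriminant a
palindrome.

The negative expansion follows from `f x = [c]_q - q^(c-1) / f (negGauss x)` with `c = ⌈x⌉`
(`IsRegSeries.eq_negStep`), again a contraction on one-units, and from the classical conversion
between the two kinds of digits. -/

namespace QDeformed

/-! ### Laurent series with integer coefficients -/

/-- The Laurent series of a power series with integer coefficients. -/
noncomputable def ofIntSeries : PowerSeries ℤ →+* ℚ⸨X⸩ :=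
  (HahnSeries.ofPowerSeries ℤ ℚ).comp (PowerSeries.map (Int.castRingHom ℚ))

theorem ofIntSeries_X : ofIntSeries PowerSeries.X = qVar := by
  simp [ofIntSeries, qVar]

theorem coeff_ofIntSeries_natCast (h : PowerSeries ℤ) (n : ℕ) :
    (ofIntSeries h).coeff (n : ℤ) = (PowerSeries.coeff n h : ℤ) := by
  simp [ofIntSeries]

theorem coeff_ofIntSeries_of_neg (h : PowerSeries ℤ) {k : ℤ} (hk : k < 0) :
    (ofIntSeries h).coeff k = 0 := by
  simp only [ofIntSeries, RingHom.comp_apply, HahnSeries.ofPowerSeries_apply]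
  apply HahnSeries.embDomain_of_notMem_range
  rintro ⟨n, hn⟩
  have h1 : (n : ℤ) = k := hn
  omega

theorem coeff_qVar_zpow_mul (k j : ℤ) (F : ℚ⸨X⸩) :
    (qVar ^ k * F).coeff j = F.coeff (j - k) := by
  have : qVar ^ k = HahnSeries.single k (1 : ℚ) := by
    rw [qVar]
    exact (RatFunc.single_zpow k).symm
  rw [this, HahnSeries.coeff_single_mul, one_mul]

theorem qVar_ne_one : qVar ≠ 1 := by
  intro h
  have := congrArg (fun F : ℚ⸨X⸩ => F.coeff 0) h
  simp [qVar, HahnSeries.coeff_one] at this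

/-- The additive group `q ^ k ℤ⟦q⟧`. -/
noncomputable def qPow (k : ℤ) : AddSubgroup ℚ⸨X⸩ :=
  AddMonoidHom.range ((AddMonoidHom.mulLeft (qVar ^ k)).comp ofIntSeries.toAddMonoidHom)

theorem mem_qPow {k : ℤ} {F : ℚ⸨X⸩} : F ∈ qPow k ↔ ∃ h, qVar ^ k * ofIntSeries h = F :=
  Iff.rfl

theorem mem_qPow_zero {F : ℚ⸨X⸩} : F ∈ qPow 0 ↔ ∃ h, ofIntSeries h = F := by
  simp [mem_qPow]

theorem mul_mem_qPow {j k : ℤ} {F G : ℚ⸨X⸩} (hF : F ∈ qPow j) (hG : G ∈ qPow k) :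
    F * G ∈ qPow (j + k) := by
  obtain ⟨f, rfl⟩ := mem_qPow.mp hF
  obtain ⟨g, rfl⟩ := mem_qPow.mp hG
  refine mem_qPow.mpr ⟨f * g, ?_⟩
  rw [map_mul, zpow_add₀ qVar_ne_zero]
  ring

theorem zpow_mem_qPow (k : ℤ) : qVar ^ k ∈ qPow k :=
  mem_qPow.mpr ⟨1, by simp⟩

theorem qVar_mem_qPow : qVar ∈ qPow 1 := by
  simpa using zpow_mem_qPow 1

theorem one_mem_qPow : (1 : ℚ⸨X⸩) ∈ qPow 0 := by
  simpa using zpow_mem_qPow 0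

theorem qPow_anti {j k : ℤ} (h : j ≤ k) : qPow k ≤ qPow j := by
  intro F hF
  obtain ⟨f, rfl⟩ := mem_qPow.mp hF
  obtain ⟨n, rfl⟩ := Int.le.dest h
  refine mem_qPow.mpr ⟨PowerSeries.X ^ n * f, ?_⟩
  rw [map_mul, map_pow, ofIntSeries_X, zpow_add₀ qVar_ne_zero, zpow_natCast]
  ring

theorem mul_mem_qPow_zero {F G : ℚ⸨X⸩} (hF : F ∈ qPow 0) (hG : G ∈ qPow 0) : F * G ∈ qPow 0 := by
  simpa using mul_mem_qPow hF hG

theorem coeff_eq_zero_of_mem_qPow {k j : ℤ} (hj : j < k) {F : ℚ⸨X⸩} (hF : F ∈ qPow k) :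
    F.coeff j = 0 := by
  obtain ⟨f, rfl⟩ := mem_qPow.mp hF
  rw [coeff_qVar_zpow_mul]
  exact coeff_ofIntSeries_of_neg f (by omega)

theorem coeff_eq_of_sub_mem_qPow {k j : ℤ} (hj : j < k) {F G : ℚ⸨X⸩} (h : F - G ∈ qPow k) :
    F.coeff j = G.coeff j := by
  have := coeff_eq_zero_of_mem_qPow hj h
  rwa [HahnSeries.coeff_sub, sub_eq_zero] at this

theorem exists_int_coeff_of_mem_qPow {k : ℤ} {F : ℚ⸨X⸩} (hF : F ∈ qPow k) (j : ℤ) :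
    ∃ m : ℤ, F.coeff j = (m : ℚ) := by
  obtain ⟨f, rfl⟩ := mem_qPow.mp hF
  rw [coeff_qVar_zpow_mul]
  rcases lt_or_ge (j - k) 0 with h | h
  · exact ⟨0, by rw [coeff_ofIntSeries_of_neg f h]; simp⟩
  · obtain ⟨n, hn⟩ := Int.eq_ofNat_of_zero_le h
    exact ⟨_, by rw [hn]; exact coeff_ofIntSeries_natCast f n⟩

theorem eq_of_forall_sub_mem_qPow {F G : ℚ⸨X⸩} (h : ∀ k : ℕ, F - G ∈ qPow k) : F = G := by
  ext j
  exact coeff_eq_of_sub_mem_qPow (k := (j.toNat + 1 : ℕ)) (by push_cast; omega) (h _)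

theorem coeffTendsto_of_eventually {u : ℕ → ℚ⸨X⸩} {F : ℚ⸨X⸩}
    (h : ∀ k : ℕ, ∀ᶠ n in atTop, u n - F ∈ qPow k) : CoeffTendsto u F := by
  intro j
  filter_upwards [h (j.toNat + 1)] with n hn
  exact coeff_eq_of_sub_mem_qPow (by push_cast; omega) hn

/-- The ring `ℤ⟦q⟧` is complete. -/
theorem exists_limit_of_sub_mem_qPow {u : ℕ → ℚ⸨X⸩} (h0 : ∀ k, u k ∈ qPow 0)
    (h : ∀ k : ℕ, u (k + 1) - u k ∈ qPow k) : ∃ F ∈ qPow 0, ∀ k : ℕ, F - u k ∈ qPow k := by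
  choose f hf using fun k => mem_qPow_zero.mp (h0 k)
  have hstep : ∀ m k, m < k → PowerSeries.coeff m (f (m + 1)) = PowerSeries.coeff m (f k) := by
    intro m k hk
    induction k, (Nat.succ_le_of_lt hk) using Nat.le_induction with
    | base => rfl
    | succ k hmk ih =>
      rw [ih (by omega)]
      have := coeff_eq_of_sub_mem_qPow (j := m) (by exact_mod_cast hmk) (h k)
      rw [← hf, ← hf, coeff_ofIntSeries_natCast, coeff_ofIntSeries_natCast] at this
      exact_mod_cast this.symm
  -- Coefficient `m` no longer changes from index `m + 1` on, since later corrections lie in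
  -- `q^(m+1)ℤ⟦q⟧`.
  refine ⟨ofIntSeries (PowerSeries.mk fun m => PowerSeries.coeff m (f (m + 1))),
    mem_qPow_zero.mpr ⟨_, rfl⟩, fun k => ?_⟩
  have hdvd : (PowerSeries.X : PowerSeries ℤ) ^ k ∣
      (PowerSeries.mk fun m => PowerSeries.coeff m (f (m + 1))) - f k := by
    rw [PowerSeries.X_pow_dvd_iff]
    intro m hm
    rw [map_sub, PowerSeries.coeff_mk, hstep m k hm, sub_self]
  obtain ⟨g, hg⟩ := hdvd
  refine mem_qPow.mpr ⟨g, ?_⟩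
  rw [← hf k, ← map_sub, hg, map_mul, map_pow, ofIntSeries_X, zpow_natCast]

/-! ### One-units -/

/-- The series `F` lies in `1 + q ℤ⟦q⟧`. -/
def IsOneUnit (F : ℚ⸨X⸩) : Prop := F - 1 ∈ qPow 1

theorem isOneUnit_one : IsOneUnit 1 := by
  simp [IsOneUnit, zero_mem]

namespace IsOneUnit

variable {F G : ℚ⸨X⸩}

theorem mem (hF : IsOneUnit F) : F ∈ qPow 0 := by
  simpa using add_mem (qPow_anti zero_le_one hF) one_mem_qPow

theorem add (hF : IsOneUnit F) (hG : G ∈ qPow 1) : IsOneUnit (F + G) := by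
  have := add_mem hF hG
  rwa [IsOneUnit, show F + G - 1 = F - 1 + G by ring]

/-- The constant coefficient is `1`, a unit of `ℤ`, so inversion creates no denominators. -/
theorem exists_mul_eq_one (hF : IsOneUnit F) : ∃ G ∈ qPow 0, F * G = 1 := by
  obtain ⟨h, hh⟩ := mem_qPow.mp hF
  have hu : IsUnit (1 + PowerSeries.X * h) := by
    rw [PowerSeries.isUnit_iff_constantCoeff]
    simp
  obtain ⟨g, hg⟩ := hu.exists_right_inv
  refine ⟨ofIntSeries g, mem_qPow_zero.mpr ⟨g, rfl⟩, ?_⟩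
  have : F = ofIntSeries (1 + PowerSeries.X * h) := by
    rw [map_add, map_mul, ofIntSeries_X, map_one]
    rw [zpow_one] at hh
    linear_combination -hh
  rw [this, ← map_mul, hg, map_one]

theorem ne_zero (hF : IsOneUnit F) : F ≠ 0 := by
  obtain ⟨G, -, h⟩ := hF.exists_mul_eq_one
  rintro rfl
  simp at h

theorem inv_mem (hF : IsOneUnit F) : F⁻¹ ∈ qPow 0 := by
  obtain ⟨G, hG, h⟩ := hF.exists_mul_eq_one
  rwa [inv_eq_of_mul_eq_one_right h]

end IsOneUnit

theorem isOneUnit_one_add {G : ℚ⸨X⸩} (hG : G ∈ qPow 1) : IsOneUnit (1 + G) := isOneUnit_one.add hG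

/-! ### `q`-integers -/

section qInt

variable {K : Type*} [Field K] {q : K}

theorem qInt_add (h0 : q ≠ 0) (h1 : q ≠ 1) (a b : ℤ) :
    qInt q (a + b) = qInt q a + q ^ a * qInt q b := by
  have : 1 - q ≠ 0 := sub_ne_zero.mpr h1.symm
  rw [qInt, qInt, qInt, zpow_add₀ h0]
  field_simp
  ring

theorem qInt_zero : qInt q 0 = 0 := by simp [qInt]

theorem qInt_one (h1 : q ≠ 1) : qInt q 1 = 1 := by
  rw [qInt, zpow_one, div_self (sub_ne_zero.mpr h1.symm)]

theorem qInt_add_one (h0 : q ≠ 0) (h1 : q ≠ 1) (a : ℤ) :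
    qInt q (a + 1) = q * qInt q a + 1 := by
  rw [add_comm, qInt_add h0 h1, qInt_one h1, zpow_one, add_comm]

theorem qInt_inv (h0 : q ≠ 0) (h1 : q ≠ 1) (b : ℤ) :
    qInt q⁻¹ b = q * qInt q b / q ^ b := by
  have : 1 - q ≠ 0 := sub_ne_zero.mpr h1.symm
  have h2 : 1 - q⁻¹ ≠ 0 := sub_ne_zero.mpr fun h => h1 (inv_eq_one.mp h.symm)
  have h3 : q ^ b ≠ 0 := zpow_ne_zero _ h0
  have h4 : q - 1 ≠ 0 := sub_ne_zero.mpr h1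
  rw [qInt, qInt, inv_zpow]
  field_simp
  ring

/-- The map `Z ↦ [a]_q + q ^ a / ([b]_{q⁻¹} + q ^ (-b) / Z)`. -/
def qStep (q : K) (a b : ℤ) (Z : K) : K := qInt q a + q ^ (a + b) * Z / (1 + q * qInt q b * Z)

/-- By `qInt_inv` the inner level equals `(1 + q [b]_q Z) / (q^b Z)`. Two levels thus bring the
parameter `q⁻¹` back to `q`, which is why digits are consumed in pairs. -/
theorem qRegCF_cons_cons (h0 : q ≠ 0) (h1 : q ≠ 1) (a b : ℤ) {l : List ℤ} (hl : l ≠ [])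
    (hZ : qRegCF q l ≠ 0) : qRegCF q (a :: b :: l) = qStep q a b (qRegCF q l) := by
  obtain ⟨c, l, rfl⟩ := List.exists_cons_of_ne_nil hl
  rw [qRegCF, qRegCF, inv_inv, qInt_inv h0 h1, qStep, zpow_add₀ h0, inv_zpow]
  have h3 : q ^ b ≠ 0 := zpow_ne_zero _ h0
  congr 1
  generalize qRegCF q (c :: l) = Z at *
  have : q * qInt q b / q ^ b + (q ^ b)⁻¹ / Z = (1 + q * qInt q b * Z) / (q ^ b * Z) := by
    field_simp
    ring
  rw [this, div_div_eq_mul_div, mul_assoc (q ^ a)]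

/-- The case `Z = ∞` of `qStep`: the factor `q` of the denominator lowers the exponent to `a + b -
1`. -/
theorem qRegCF_pair (h0 : q ≠ 0) (h1 : q ≠ 1) (a b : ℤ) :
    qRegCF q [a, b] = qInt q a + q ^ (a + b - 1) / qInt q b := by
  rw [qRegCF, qRegCF, qInt_inv h0 h1, zpow_sub_one₀ h0, zpow_add₀ h0]
  congr 1
  rw [div_div_eq_mul_div, mul_comm q, ← div_div, div_right_comm, div_eq_mul_inv (q ^ a * q ^ b)]

theorem qStep_add_one (h0 : q ≠ 0) (h1 : q ≠ 1) (a b : ℤ) (Z : K) :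
    qStep q (a + 1) b Z = q * qStep q a b Z + 1 := by
  rw [qStep, qStep, qInt_add_one h0 h1, add_right_comm a 1 b, zpow_add_one₀ h0]
  ring

end qInt

theorem qInt_natCast_mem (n : ℕ) : qInt qVar n ∈ qPow 0 := by
  induction n with
  | zero => simp [qInt_zero, zero_mem]
  | succ n ih =>
    push_cast
    rw [qInt_add_one qVar_ne_zero qVar_ne_one]
    exact add_mem (mul_mem_qPow_zero (qPow_anti zero_le_one qVar_mem_qPow) ih) one_mem_qPow

theorem qInt_mem_of_nonneg {a : ℤ} (ha : 0 ≤ a) : qInt qVar a ∈ qPow 0 := by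
  lift a to ℕ using ha
  exact qInt_natCast_mem a

theorem qInt_isOneUnit {a : ℤ} (ha : 1 ≤ a) : IsOneUnit (qInt qVar a) := by
  obtain ⟨b, rfl⟩ : ∃ b, a = b + 1 := ⟨a - 1, by ring⟩
  rw [qInt_add_one qVar_ne_zero qVar_ne_one, add_comm]
  exact isOneUnit_one_add (by
    simpa using mul_mem_qPow qVar_mem_qPow (qInt_mem_of_nonneg (a := b) (by omega)))

/-- Every `q`-integer is a Laurent series with integer coefficients. -/
theorem exists_qInt_mem (a : ℤ) : ∃ k, qInt qVar a ∈ qPow k := by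
  rcases le_total 0 a with h | h
  · exact ⟨0, qInt_mem_of_nonneg h⟩
  · refine ⟨a, ?_⟩
    have h1 := qInt_add qVar_ne_zero qVar_ne_one a (-a)
    rw [add_neg_cancel, qInt_zero] at h1
    rw [eq_neg_of_add_eq_zero_left h1.symm]
    simpa using neg_mem (mul_mem_qPow (zpow_mem_qPow a) (qInt_mem_of_nonneg (a := -a) (by omega)))

/-! ### The steps of the expansions are contractions -/

section qStep

variable {a b k : ℤ} {Z W : ℚ⸨X⸩}

theorem isOneUnit_qStep_denominator (hb : 1 ≤ b) (hZ : IsOneUnit Z) :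
    IsOneUnit (1 + qVar * qInt qVar b * Z) := by
  refine isOneUnit_one_add ?_
  simpa using mul_mem_qPow
    (mul_mem_qPow qVar_mem_qPow (qInt_mem_of_nonneg (a := b) (by omega))) hZ.mem

theorem qStep_isOneUnit (ha : 1 ≤ a) (hb : 1 ≤ b) (hZ : IsOneUnit Z) :
    IsOneUnit (qStep qVar a b Z) := by
  refine (qInt_isOneUnit ha).add (qPow_anti (j := 1) (k := a + b) (by omega) ?_)
  simpa [div_eq_mul_inv] using mul_mem_qPow (mul_mem_qPow (zpow_mem_qPow (a + b)) hZ.mem)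
    (isOneUnit_qStep_denominator hb hZ).inv_mem

theorem exists_qStep_mem (hb : 1 ≤ b) (hZ : IsOneUnit Z) : ∃ k, qStep qVar a b Z ∈ qPow k := by
  obtain ⟨k, hk⟩ := exists_qInt_mem a
  refine ⟨min k (a + b), add_mem (qPow_anti (min_le_left _ _) hk)
    (qPow_anti (min_le_right _ _) ?_)⟩
  simpa [div_eq_mul_inv] using mul_mem_qPow (mul_mem_qPow (zpow_mem_qPow (a + b)) hZ.mem)
    (isOneUnit_qStep_denominator hb hZ).inv_mem

/-- A Möbius map multiplies differences by its determinant, here `q^(a+b)`, over the two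
denominators, which are one-units. The digit `a` is arbitrary: a negative first digit costs
precision, but only a fixed amount. -/
theorem qStep_sub_mem (hb : 1 ≤ b) (hZ : IsOneUnit Z) (hW : IsOneUnit W) (h : Z - W ∈ qPow k) :
    qStep qVar a b Z - qStep qVar a b W ∈ qPow (a + b + k) := by
  have hz := isOneUnit_qStep_denominator hb hZ
  have hw := isOneUnit_qStep_denominator hb hW
  have : qStep qVar a b Z - qStep qVar a b W = qVar ^ (a + b) * (Z - W) *
      (1 + qVar * qInt qVar b * Z)⁻¹ * (1 + qVar * qInt qVar b * W)⁻¹ := by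
    have h1 := hz.ne_zero
    have h2 := hw.ne_zero
    rw [qStep, qStep, add_sub_add_left_eq_sub, div_sub_div _ _ h1 h2, mul_assoc _ _⁻¹ _⁻¹,
      ← mul_inv, ← div_eq_mul_inv]
    congr 1
    ring
  rw [this]
  simpa using mul_mem_qPow (mul_mem_qPow (mul_mem_qPow (zpow_mem_qPow (a + b)) h) hz.inv_mem)
    hw.inv_mem

/-- The step of the negative expansion is a contraction. -/
theorem qNegStep_sub_mem (hZ : IsOneUnit Z) (hW : IsOneUnit W) (h : Z - W ∈ qPow k) (c : ℤ) :
    (qInt qVar c - qVar ^ (c - 1) / Z) - (qInt qVar c - qVar ^ (c - 1) / W) ∈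
      qPow (c - 1 + k) := by
  have : (qInt qVar c - qVar ^ (c - 1) / Z) - (qInt qVar c - qVar ^ (c - 1) / W) =
      qVar ^ (c - 1) * (Z - W) * Z⁻¹ * W⁻¹ := by
    have h1 := hZ.ne_zero
    have h2 := hW.ne_zero
    field_simp
    ring
  rw [this]
  simpa using mul_mem_qPow (mul_mem_qPow (mul_mem_qPow (zpow_mem_qPow (c - 1)) h) hZ.inv_mem)
    hW.inv_mem

/-- The bound `2 ≤ c` is what puts `q^(c-1) / Z` into `qℤ⟦q⟧`. -/
theorem qNegStep_isOneUnit {c : ℤ} (hc : 2 ≤ c) (hZ : IsOneUnit Z) :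
    IsOneUnit (qInt qVar c - qVar ^ (c - 1) / Z) := by
  rw [sub_eq_add_neg]
  refine (qInt_isOneUnit (by omega)).add (neg_mem (qPow_anti (j := 1) (k := c - 1) (by omega) ?_))
  simpa [div_eq_mul_inv] using mul_mem_qPow (zpow_mem_qPow (c - 1)) hZ.inv_mem

end qStep

/-! ### The Gauss map and the digits of the regular expansion -/

/-- The map sending `[a₁, a₂, …]` to `[a₂, a₃, …]`. -/
noncomputable def gauss (x : ℝ) : ℝ := (Int.fract x)⁻¹

/-- The digits of the regular continued fraction of `x`. -/
noncomputable def digit (x : ℝ) (n : ℕ) : ℤ := ⌊gauss^[n] x⌋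

theorem fract_pos_of_irrational {x : ℝ} (hx : Irrational x) : 0 < Int.fract x := by
  refine lt_of_le_of_ne (Int.fract_nonneg x) fun h => hx ⟨⌊x⌋, ?_⟩
  rw [Int.fract] at h
  push_cast
  linarith

theorem irrational_gauss {x : ℝ} (hx : Irrational x) : Irrational (gauss x) := by
  rw [gauss, Int.fract]
  exact (hx.sub_intCast _).inv

theorem one_lt_gauss {x : ℝ} (hx : Irrational x) : 1 < gauss x :=
  (one_lt_inv₀ (fract_pos_of_irrational hx)).mpr (Int.fract_lt_one x)

theorem floor_add_inv_gauss (x : ℝ) : (⌊x⌋ : ℝ) + (gauss x)⁻¹ = x := by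
  rw [gauss, inv_inv, Int.floor_add_fract]

theorem one_le_floor {x : ℝ} (hx : 1 < x) : 1 ≤ ⌊x⌋ := Int.le_floor.mpr (by simpa using hx.le)

theorem one_le_floor_gauss {x : ℝ} (hx : Irrational x) : 1 ≤ ⌊gauss x⌋ :=
  one_le_floor (one_lt_gauss hx)

theorem irrational_gauss_iterate {x : ℝ} (hx : Irrational x) (n : ℕ) :
    Irrational (gauss^[n] x) := by
  induction n with
  | zero => exact hx
  | succ n ih => rw [Function.iterate_succ_apply']; exact irrational_gauss ih

theorem one_lt_gauss_iterate {x : ℝ} (hx : Irrational x) {n : ℕ} (hn : 1 ≤ n) :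
    1 < gauss^[n] x := by
  obtain ⟨n, rfl⟩ := Nat.exists_eq_add_of_le' hn
  rw [Function.iterate_succ_apply']
  exact one_lt_gauss (irrational_gauss_iterate hx n)

theorem eventually_floor_eq {x : ℝ} (hx : Irrational x) : ∀ᶠ y in 𝓝 x, ⌊y⌋ = ⌊x⌋ := by
  have h1 : (⌊x⌋ : ℝ) < x := by
    have := fract_pos_of_irrational hx
    rw [Int.fract] at this
    linarith
  filter_upwards [Ioo_mem_nhds h1 (Int.lt_floor_add_one x)] with y hy
  exact Int.floor_eq_iff.mpr ⟨hy.1.le, hy.2⟩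

theorem tendsto_gauss {x : ℝ} (hx : Irrational x) : Tendsto gauss (𝓝 x) (𝓝 (gauss x)) := by
  have h : Tendsto (fun y : ℝ => (y - ⌊x⌋)⁻¹) (𝓝 x) (𝓝 (gauss x)) := by
    refine Tendsto.inv₀ (tendsto_id.sub_const _) ?_
    exact (fract_pos_of_irrational hx).ne'
  refine h.congr' ?_
  filter_upwards [eventually_floor_eq hx] with y hy
  rw [gauss, Int.fract, hy]

theorem eventually_fract_ne_zero {x : ℝ} (hx : Irrational x) : ∀ᶠ y in 𝓝 x, Int.fract y ≠ 0 := by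
  -- Near `x` the values of `gauss` are positive, whereas `gauss` is `0` at integers because `0⁻¹ =
  -- 0`.
  have h := (tendsto_gauss hx).eventually
    (lt_mem_nhds (zero_lt_one.trans (one_lt_gauss hx)))
  filter_upwards [h] with y hy h0
  simp [gauss, h0] at hy

theorem truncation_succ (a : ℕ → ℤ) (n : ℕ) :
    truncation a (n + 1) = a 0 :: truncation (fun i => a (i + 1)) n := by
  simp [truncation, List.range_succ_eq_map, Function.comp_def]

theorem truncation_ne_nil (a : ℕ → ℤ) (n : ℕ) : truncation a (n + 1) ≠ [] := by
  simp [truncation_succ]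

theorem truncation_digit_succ (x : ℝ) (n : ℕ) :
    truncation (digit x) (n + 1) = ⌊x⌋ :: truncation (digit (gauss x)) n := by
  rw [truncation_succ]
  rfl

/-! ### The series attached to irrational numbers -/

/-- The function `f` attaches to irrational numbers the `q`-deformed regular continued fraction
of their digits. -/
def IsRegSeries (f : ℝ → ℚ⸨X⸩) : Prop :=
  ∀ x, Irrational x → f x = qStep qVar ⌊x⌋ ⌊gauss x⌋ (f (gauss (gauss x))) ∧
    (1 < x → IsOneUnit (f x))

/-- Truncated `q`-deformed continued fractions. -/
noncomputable def qApprox : ℕ → ℝ → ℚ⸨X⸩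
  | 0, _ => 1
  | k + 1, x => qStep qVar ⌊x⌋ ⌊gauss x⌋ (qApprox k (gauss (gauss x)))

theorem qApprox_isOneUnit (k : ℕ) {x : ℝ} (hx : Irrational x) (h1 : 1 < x) :
    IsOneUnit (qApprox k x) := by
  induction k generalizing x with
  | zero => exact isOneUnit_one
  | succ k ih =>
    exact qStep_isOneUnit (one_le_floor h1) (one_le_floor_gauss hx)
      (ih (irrational_gauss (irrational_gauss hx)) (one_lt_gauss (irrational_gauss hx)))

theorem qStep_digit_sub_mem {x : ℝ} (hx : Irrational x) (h1 : 1 < x) {k : ℕ} {Z W : ℚ⸨X⸩}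
    (hZ : IsOneUnit Z) (hW : IsOneUnit W) (h : Z - W ∈ qPow k) :
    qStep qVar ⌊x⌋ ⌊gauss x⌋ Z - qStep qVar ⌊x⌋ ⌊gauss x⌋ W ∈ qPow (k + 1 : ℕ) := by
  refine qPow_anti ?_ (qStep_sub_mem (one_le_floor_gauss hx) hZ hW h)
  have := one_le_floor h1
  have := one_le_floor_gauss hx
  push_cast
  omega

theorem qApprox_sub_mem (k : ℕ) {x : ℝ} (hx : Irrational x) (h1 : 1 < x) :
    qApprox (k + 1) x - qApprox k x ∈ qPow k := by
  induction k generalizing x with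
  | zero =>
    exact sub_mem (qApprox_isOneUnit 1 hx h1).mem (qApprox_isOneUnit 0 hx h1).mem
  | succ k ih =>
    have h2 := irrational_gauss (irrational_gauss hx)
    have h3 := one_lt_gauss (irrational_gauss hx)
    exact qStep_digit_sub_mem hx h1 (qApprox_isOneUnit _ h2 h3) (qApprox_isOneUnit _ h2 h3)
      (ih h2 h3)

theorem exists_isRegSeries : ∃ f, IsRegSeries f := by
  have key : ∀ x : ℝ, ∃ F : ℚ⸨X⸩, Irrational x → 1 < x →
      IsOneUnit F ∧ ∀ k : ℕ, F - qApprox k x ∈ qPow k := by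
    intro x
    by_cases hx : Irrational x ∧ 1 < x
    · obtain ⟨F, -, hF⟩ := exists_limit_of_sub_mem_qPow
        (fun k => (qApprox_isOneUnit k hx.1 hx.2).mem)
        (fun k => qApprox_sub_mem k hx.1 hx.2)
      refine ⟨F, fun _ _ => ⟨?_, hF⟩⟩
      have := (qApprox_isOneUnit 1 hx.1 hx.2).add (hF 1)
      rwa [add_sub_cancel] at this
    · exact ⟨0, fun h h1 => absurd ⟨h, h1⟩ hx⟩
  choose f hf using key
  have hfix : ∀ x, Irrational x → 1 < x →
      f x = qStep qVar ⌊x⌋ ⌊gauss x⌋ (f (gauss (gauss x))) := by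
    intro x hx h1
    have h2 := irrational_gauss (irrational_gauss hx)
    have h3 := one_lt_gauss (irrational_gauss hx)
    refine eq_of_forall_sub_mem_qPow fun k => ?_
    have h4 := (hf x hx h1).2 (k + 1)
    have h5 := qStep_digit_sub_mem hx h1 (hf _ h2 h3).1 (qApprox_isOneUnit k h2 h3)
      ((hf _ h2 h3).2 k)
    have := sub_mem h4 h5
    rw [qApprox, sub_sub_sub_cancel_right] at this
    exact qPow_anti (by push_cast; omega) this
  -- So far `f` is meaningful only for `x > 1`, where both digits are positive. As `gauss (gauss x)
  -- > 1` always holds, one more step extends it to every irrational, and `hfix` shows that nothing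
  -- changes where it was already defined.
  refine ⟨fun x => qStep qVar ⌊x⌋ ⌊gauss x⌋ (f (gauss (gauss x))), fun x hx => ⟨?_, fun h1 => ?_⟩⟩
  · beta_reduce
    rw [← hfix _ (irrational_gauss (irrational_gauss hx)) (one_lt_gauss (irrational_gauss hx))]
  · beta_reduce
    rw [← hfix x hx h1]
    exact (hf x hx h1).1

/-! ### Limits of `q`-deformed rational numbers -/

theorem qRegCF_isOneUnit : ∀ l : List ℤ, Even l.length → l ≠ [] → (∀ a ∈ l, 1 ≤ a) →
    IsOneUnit (qRegCF qVar l)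
  | [], _, h, _ => absurd rfl h
  | [a], h, _, _ => by simp at h
  | [a, b], _, _, h => by
    have ha : 1 ≤ a := h a (by simp)
    have hb : 1 ≤ b := h b (by simp)
    rw [qRegCF_pair qVar_ne_zero qVar_ne_one, div_eq_mul_inv]
    refine (qInt_isOneUnit ha).add (qPow_anti (j := 1) (k := a + b - 1) (by omega) ?_)
    simpa using mul_mem_qPow (zpow_mem_qPow (a + b - 1)) (qInt_isOneUnit hb).inv_mem
  | a :: b :: c :: l, hl, _, h => by
    have ih := qRegCF_isOneUnit (c :: l) (by simpa [Nat.even_add_one] using hl) (by simp)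
      fun d hd => h d (by simp only [List.mem_cons] at hd ⊢; tauto)
    rw [qRegCF_cons_cons qVar_ne_zero qVar_ne_one a b (by simp) ih.ne_zero]
    exact qStep_isOneUnit (h a (by simp)) (h b (by simp)) ih

theorem qRat_isOneUnit {y : ℚ} (hy : 1 < y) : IsOneUnit (qRat y) := by
  obtain ⟨h1, ⟨a, b, l, h2, -⟩, -, h4, -⟩ := evenExpansion_spec y
  exact qRegCF_isOneUnit _ h1 (by simp [h2]) (h4 hy)

theorem gauss_ratCast (y : ℚ) : gauss y = ((Int.fract y)⁻¹ : ℚ) := by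
  simp [gauss, Rat.cast_fract]

theorem qRat_eq_qStep {y : ℚ} (hy : Int.fract (y : ℝ) ≠ 0) (hz : Int.fract (gauss y) ≠ 0) :
    ∃ z : ℚ, 1 < z ∧ (z : ℝ) = gauss (gauss y) ∧
      qRat y = qStep qVar ⌊(y : ℝ)⌋ ⌊gauss y⌋ (qRat z) := by
  rw [← Rat.cast_fract, Rat.cast_ne_zero] at hy
  rw [gauss_ratCast, ← Rat.cast_fract, Rat.cast_ne_zero] at hz
  have hpos := lt_of_le_of_ne (Int.fract_nonneg _) (Ne.symm hz)
  have h1 : 1 < (Int.fract (Int.fract y)⁻¹)⁻¹ :=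
    (one_lt_inv₀ hpos).mpr (Int.fract_lt_one _)
  refine ⟨_, h1, ?_, ?_⟩
  · rw [gauss_ratCast, gauss_ratCast]
  · obtain ⟨-, ⟨a, b, l, h2, -⟩, -⟩ := evenExpansion_spec (Int.fract (Int.fract y)⁻¹)⁻¹
    rw [gauss_ratCast, Rat.floor_cast, Rat.floor_cast, qRat, evenExpansion, dif_neg hy, dif_neg hz,
      qRegCF_cons_cons qVar_ne_zero qVar_ne_one _ _ (by simp [h2]) (qRat_isOneUnit h1).ne_zero]
    rfl

/-- Near an irrational point both `gauss` and the first two digits vary continuously, and neither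
fractional part vanishes. So a nearby rational takes the same step as `x` and leaves a tail close to
`gauss (gauss x)`. This drives the induction on `q`-adic precision. -/
theorem eventually_qRat_eq_qStep {x : ℝ} (hx : Irrational x) {p : ℝ → Prop}
    (hp : ∀ᶠ z in 𝓝 (gauss (gauss x)), p z) :
    ∀ᶠ w in 𝓝 x, ∀ y : ℚ, (y : ℝ) = w →
      ∃ z : ℚ, 1 < z ∧ p z ∧ qRat y = qStep qVar ⌊x⌋ ⌊gauss x⌋ (qRat z) := by
  have hg := irrational_gauss hx
  filter_upwards [eventually_floor_eq hx, (tendsto_gauss hx).eventually (eventually_floor_eq hg),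
    eventually_fract_ne_zero hx, (tendsto_gauss hx).eventually (eventually_fract_ne_zero hg),
    ((tendsto_gauss hg).comp (tendsto_gauss hx)).eventually hp] with w h1 h2 h3 h4 h5 y hy
  subst hy
  obtain ⟨z, hz1, hz2, hz3⟩ := qRat_eq_qStep h3 h4
  refine ⟨z, hz1, ?_, ?_⟩
  · rw [hz2]; exact h5
  · rw [hz3, h1, h2]

variable {f : ℝ → ℚ⸨X⸩}

theorem IsRegSeries.isOneUnit_gauss (hf : IsRegSeries f) {x : ℝ} (hx : Irrational x) :
    IsOneUnit (f (gauss x)) :=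
  (hf _ (irrational_gauss hx)).2 (one_lt_gauss hx)

theorem IsRegSeries.eventually_qRat_sub_mem_of_one_lt (hf : IsRegSeries f) (k : ℕ) {x : ℝ}
    (hx : Irrational x) (h1 : 1 < x) :
    ∀ᶠ w in 𝓝 x, ∀ y : ℚ, (y : ℝ) = w → qRat y - f x ∈ qPow k := by
  induction k generalizing x with
  | zero =>
    filter_upwards [lt_mem_nhds h1] with w hw y hy
    rw [← hy] at hw
    exact sub_mem (qRat_isOneUnit (by exact_mod_cast hw)).mem ((hf x hx).2 h1).mem
  | succ k ih =>
    have h2 := irrational_gauss hx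
    filter_upwards [eventually_qRat_eq_qStep hx (ih (irrational_gauss h2) (one_lt_gauss h2))]
      with w hw y hy
    obtain ⟨z, hz1, hz2, hz3⟩ := hw y hy
    rw [hz3, (hf x hx).1]
    exact qStep_digit_sub_mem hx h1 (qRat_isOneUnit hz1) (hf.isOneUnit_gauss h2) (hz2 z rfl)

theorem IsRegSeries.eventually_qRat_sub_mem (hf : IsRegSeries f) (k : ℕ) {x : ℝ}
    (hx : Irrational x) : ∀ᶠ w in 𝓝 x, ∀ y : ℚ, (y : ℝ) = w → qRat y - f x ∈ qPow k := by
  have h2 := irrational_gauss hx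
  -- The first step shifts precision by `⌊x⌋ + ⌊gauss x⌋`, possibly negative, so the tail is taken
  -- with precision `k` minus this shift.
  filter_upwards [eventually_qRat_eq_qStep hx (hf.eventually_qRat_sub_mem_of_one_lt
    (k - ⌊x⌋ - ⌊gauss x⌋).toNat (irrational_gauss h2) (one_lt_gauss h2))] with w hw y hy
  obtain ⟨z, hz1, hz2, hz3⟩ := hw y hy
  rw [hz3, (hf x hx).1]
  exact qPow_anti (by omega) (qStep_sub_mem (one_le_floor_gauss hx) (qRat_isOneUnit hz1)
    (hf.isOneUnit_gauss h2) (hz2 z rfl))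

theorem IsRegSeries.isQDeformation (hf : IsRegSeries f) {x : ℝ} (hx : Irrational x) :
    IsQDeformation x (f x) := by
  constructor
  · rw [(hf x hx).1]
    obtain ⟨k, hk⟩ := exists_qStep_mem (a := ⌊x⌋) (one_le_floor_gauss hx)
      (hf.isOneUnit_gauss (irrational_gauss hx))
    exact exists_int_coeff_of_mem_qPow hk
  · intro y hy
    refine coeffTendsto_of_eventually fun k => ?_
    filter_upwards [hy.eventually (hf.eventually_qRat_sub_mem k hx)] with n hn
    exact hn _ rfl

theorem IsRegSeries.qReal_eq (hf : IsRegSeries f) {x : ℝ} (hx : Irrational x) :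
    qReal x = f x := by
  have h1 : ¬ ∃ y : ℚ, (y : ℝ) = x := hx
  have h2 : ∃ F, IsQDeformation x F := ⟨_, hf.isQDeformation hx⟩
  rw [qReal, dif_neg h1, dif_pos h2]
  exact h2.choose_spec.unique (hf.isQDeformation hx)

/-! ### Convergence of the regular expansion -/

theorem qRegCF_truncation_isOneUnit (m : ℕ) {x : ℝ} (hx : Irrational x) (h1 : 1 < x) :
    IsOneUnit (qRegCF qVar (truncation (digit x) (2 * (m + 1)))) := by
  refine qRegCF_isOneUnit _ (by simp [truncation]) (by simp [truncation]) ?_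
  simp only [truncation, List.mem_map, List.mem_range, forall_exists_index, and_imp]
  rintro _ n - rfl
  refine one_le_floor ?_
  cases n with
  | zero => exact h1
  | succ n => exact one_lt_gauss_iterate hx (by omega)

theorem IsRegSeries.truncation_sub_mem_of_one_lt (hf : IsRegSeries f) (m : ℕ) {x : ℝ}
    (hx : Irrational x) (h1 : 1 < x) :
    qRegCF qVar (truncation (digit x) (2 * (m + 1))) - f x ∈ qPow m := by
  induction m generalizing x with
  | zero => exact sub_mem (qRegCF_truncation_isOneUnit 0 hx h1).mem ((hf x hx).2 h1).mem
  | succ m ih =>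
    have h2 := irrational_gauss hx
    have h3 := irrational_gauss h2
    have h4 := qRegCF_truncation_isOneUnit m h3 (one_lt_gauss h2)
    rw [show 2 * (m + 1 + 1) = 2 * (m + 1) + 1 + 1 by ring, truncation_digit_succ,
      truncation_digit_succ, qRegCF_cons_cons qVar_ne_zero qVar_ne_one _ _
      (by simp [truncation]) h4.ne_zero, (hf x hx).1]
    exact qStep_digit_sub_mem hx h1 h4 (hf.isOneUnit_gauss h2) (ih h3 (one_lt_gauss h2))

theorem IsRegSeries.coeffTendsto_truncation (hf : IsRegSeries f) {x : ℝ} (hx : Irrational x) :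
    CoeffTendsto (fun m => qRegCF qVar (truncation (digit x) (2 * m))) (f x) := by
  refine coeffTendsto_of_eventually fun k => ?_
  have h2 := irrational_gauss hx
  -- Without its first pair the truncation has `2 * (m - 1)` digits, which gives precision `m - 2`
  -- for the tail.
  filter_upwards [eventually_ge_atTop ((k - ⌊x⌋ - ⌊gauss x⌋).toNat + 2)] with m hm
  obtain ⟨n, rfl⟩ := Nat.exists_eq_add_of_le' (show 2 ≤ m by omega)
  have h4 := qRegCF_truncation_isOneUnit n (irrational_gauss h2) (one_lt_gauss h2)
  have h5 := hf.truncation_sub_mem_of_one_lt n (irrational_gauss h2) (one_lt_gauss h2)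
  rw [show 2 * (n + 2) = 2 * (n + 1) + 1 + 1 by ring, truncation_digit_succ,
      truncation_digit_succ, qRegCF_cons_cons qVar_ne_zero qVar_ne_one _ _
      (by simp [truncation]) h4.ne_zero, (hf x hx).1]
  exact qPow_anti (by omega) (qStep_sub_mem (one_le_floor_gauss hx) h4
    (hf.isOneUnit_gauss h2) h5)

theorem regCF_cons (a : ℤ) {l : List ℤ} (hl : l ≠ []) :
    (regCF (a :: l) : ℝ) = a + (regCF l)⁻¹ := by
  obtain ⟨b, l, rfl⟩ := List.exists_cons_of_ne_nil hl
  rw [regCF, one_div]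

theorem regCF_truncation_digit (x : ℝ) (n : ℕ) :
    (regCF (truncation (digit x) (n + 2)) : ℝ) =
      ⌊x⌋ + (regCF (truncation (digit (gauss x)) (n + 1)))⁻¹ := by
  rw [truncation_digit_succ, regCF_cons _ (truncation_ne_nil _ _)]

theorem one_le_regCF_truncation_digit (n : ℕ) {x : ℝ} (hx : Irrational x) (h1 : 1 < x) :
    1 ≤ (regCF (truncation (digit x) (n + 1)) : ℝ) := by
  have h : (1 : ℝ) ≤ ⌊x⌋ := by exact_mod_cast one_le_floor h1
  induction n generalizing x with
  | zero => simpa [truncation, regCF, digit] using h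
  | succ n ih =>
    rw [regCF_truncation_digit]
    have h2 := one_lt_gauss hx
    have := ih (irrational_gauss hx) h2 (by exact_mod_cast one_le_floor h2)
    have : (0 : ℝ) ≤ (regCF (truncation (digit (gauss x)) (n + 1)))⁻¹ := by positivity
    linarith

/-- A single step divides the error by a product that may be close to `1`. Over two consecutive
steps this bound guarantees a factor of at least `2`, whence geometric convergence. -/
theorem two_le_mul_gauss {x : ℝ} (hx : Irrational x) (h1 : 1 < x) : 2 ≤ x * gauss x := by
  have h : (1 : ℝ) ≤ ⌊x⌋ := by exact_mod_cast one_le_floor h1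
  have h2 := one_lt_gauss hx
  have h3 := floor_add_inv_gauss x
  have h4 : x * gauss x = ⌊x⌋ * gauss x + 1 := by
    nth_rewrite 1 [← h3]
    field_simp
  nlinarith

theorem abs_add_inv_sub_add_inv {a u v : ℝ} (hu : 0 < u) (hv : 0 < v) :
    |(a + u⁻¹) - (a + v⁻¹)| = |u - v| / (u * v) := by
  have : (a + u⁻¹) - (a + v⁻¹) = (v - u) / (u * v) := by
    field_simp
    ring
  rw [this, abs_div, abs_sub_comm, abs_of_pos (mul_pos hu hv)]

theorem abs_regCF_truncation_sub_le (k : ℕ) {x : ℝ} (hx : Irrational x) (h1 : 1 < x) :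
    |(regCF (truncation (digit x) (2 * k + 1)) : ℝ) - x| ≤ (1 / 2) ^ k ∧
      |(regCF (truncation (digit x) (2 * k + 2)) : ℝ) - x| ≤ (1 / 2) ^ k := by
  induction k generalizing x with
  | zero =>
    have h2 := one_lt_gauss hx
    have h3 := Int.floor_le x
    have h4 := Int.lt_floor_add_one x
    constructor
    · simp only [mul_zero, zero_add, pow_zero, abs_le, truncation, List.range_one, List.map_cons,
        List.map_nil, regCF, digit, Function.iterate_zero, id]
      constructor <;> linarith
    · have h5 := one_le_regCF_truncation_digit 0 (irrational_gauss hx) h2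
      have h6 := inv_le_one_of_one_le₀ h5
      have h7 : 0 < ((regCF (truncation (digit (gauss x)) (0 + 1)))⁻¹ : ℝ) := by positivity
      rw [mul_zero, regCF_truncation_digit, pow_zero, abs_le]
      constructor <;> linarith
  | succ k ih =>
    have hg := irrational_gauss hx
    have h2 := one_lt_gauss hx
    have h3 := one_lt_gauss hg
    have step : ∀ n, |(regCF (truncation (digit (gauss (gauss x))) (n + 1)) : ℝ)
        - gauss (gauss x)| ≤ (1 / 2) ^ k →
        |(regCF (truncation (digit x) (n + 3)) : ℝ) - x| ≤ (1 / 2) ^ (k + 1) := by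
      intro n hn
      have h4 := one_le_regCF_truncation_digit (n + 1) hg h2
      have h5 := one_le_regCF_truncation_digit n (irrational_gauss hg) h3
      have h6 := two_le_mul_gauss hg h2
      have e1 := abs_add_inv_sub_add_inv (a := ⌊x⌋) (zero_lt_one.trans_le h4) (zero_lt_one.trans h2)
      have e2 := abs_add_inv_sub_add_inv (a := ⌊gauss x⌋) (zero_lt_one.trans_le h5)
        (zero_lt_one.trans h3)
      rw [floor_add_inv_gauss, ← regCF_truncation_digit] at e1 e2
      rw [e1, e2, div_div, pow_succ, ← div_eq_mul_one_div]
      refine div_le_div₀ (by positivity) hn two_pos ?_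
      calc (2 : ℝ) ≤ 1 * 1 * (gauss x * gauss (gauss x)) := by linarith
        _ ≤ _ := mul_le_mul_of_nonneg_right (mul_le_mul h5 h4 zero_le_one (by linarith))
          (by linarith)
        _ = _ := by ring
    obtain ⟨ih1, ih2⟩ := ih (irrational_gauss hg) h3
    exact ⟨step (2 * k) ih1, step (2 * k + 1) ih2⟩

theorem tendsto_regCF_truncation_of_one_lt {x : ℝ} (hx : Irrational x) (h1 : 1 < x) :
    Tendsto (fun n => (regCF (truncation (digit x) n) : ℝ)) atTop (𝓝 x) := by
  rw [← tendsto_add_atTop_iff_nat 1, tendsto_iff_dist_tendsto_zero]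
  have hdiv : Tendsto (fun n : ℕ => ((1 : ℝ) / 2) ^ (n / 2)) atTop (𝓝 0) :=
    (tendsto_pow_atTop_nhds_zero_of_lt_one (by norm_num) (by norm_num)).comp
      (Nat.tendsto_div_const_atTop two_ne_zero)
  refine squeeze_zero (fun _ => dist_nonneg) (fun n => ?_) hdiv
  rw [Real.dist_eq]
  obtain ⟨h2, h3⟩ := abs_regCF_truncation_sub_le (n / 2) hx h1
  rcases Nat.mod_two_eq_zero_or_one n with h | h
  · rwa [show 2 * (n / 2) + 1 = n + 1 by omega] at h2
  · rwa [show 2 * (n / 2) + 2 = n + 1 by omega] at h3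

theorem tendsto_regCF_truncation {x : ℝ} (hx : Irrational x) :
    Tendsto (fun n => (regCF (truncation (digit x) n) : ℝ)) atTop (𝓝 x) := by
  rw [← tendsto_add_atTop_iff_nat 2]
  simp only [regCF_truncation_digit]
  have h := (tendsto_add_atTop_iff_nat 1).mpr
    (tendsto_regCF_truncation_of_one_lt (irrational_gauss hx) (one_lt_gauss hx))
  have := (h.inv₀ (zero_lt_one.trans (one_lt_gauss hx)).ne').const_add (⌊x⌋ : ℝ)
  rwa [floor_add_inv_gauss] at this

/-- An irrational number is determined by its digits. -/
theorem eq_of_digit_eq {x y : ℝ} (hx : Irrational x) (hy : Irrational y) (h : digit x = digit y) :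
    x = y := by
  have h1 := tendsto_regCF_truncation hx
  rw [h] at h1
  exact tendsto_nhds_unique h1 (tendsto_regCF_truncation hy)

/-! ### Periodicity of the regular expansion -/

theorem iterate_add_eq_of_le {α : Type*} {f : α → α} {x : α} {N t : ℕ}
    (h : f^[N + t] x = f^[N] x) {n : ℕ} (hn : N ≤ n) : f^[n + t] x = f^[n] x := by
  obtain ⟨k, rfl⟩ := Nat.exists_eq_add_of_le' hn
  rw [add_assoc, Function.iterate_add_apply, h, ← Function.iterate_add_apply]

/-- The numbers `x` and `x'` are the roots of an integral quadratic form of discriminant `D`. -/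
def AreConjugate (D : ℤ) (x x' : ℝ) : Prop :=
  ∃ A B C : ℤ, A ≠ 0 ∧ B ^ 2 - 4 * A * C = D ∧ (A : ℝ) * (x + x') = -B ∧ (A : ℝ) * (x * x') = C

theorem AreConjugate.irrational {D : ℤ} {x x' : ℝ} (h : AreConjugate D x x')
    (hx : Irrational x) : Irrational x' := by
  obtain ⟨A, B, C, hA, -, h1, -⟩ := h
  rintro ⟨r, rfl⟩
  refine hx ⟨-B / A - r, ?_⟩
  have : (A : ℝ) ≠ 0 := by exact_mod_cast hA
  push_cast
  field_simp
  linarith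

theorem AreConjugate.gauss {D : ℤ} {x x' : ℝ} (h : AreConjugate D x x') (hx : Irrational x) :
    AreConjugate D (gauss x) (x' - ⌊x⌋)⁻¹ := by
  have hx' := h.irrational hx
  obtain ⟨A, B, C, hA, hD, h1, h2⟩ := h
  have e1 : x - ⌊x⌋ ≠ 0 := sub_ne_zero.mpr fun h => hx ⟨⌊x⌋, by simpa using h.symm⟩
  have e2 : x' - ⌊x⌋ ≠ 0 := sub_ne_zero.mpr fun h => hx' ⟨⌊x⌋, by simpa using h.symm⟩
  have e3 : (A : ℝ) ≠ 0 := by exact_mod_cast hA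
  have e4 : ((A * ⌊x⌋ ^ 2 + B * ⌊x⌋ + C : ℤ) : ℝ) = A * (x - ⌊x⌋) * (x' - ⌊x⌋) := by
    push_cast
    linear_combination -h2 + h1 * (⌊x⌋ : ℝ)
  -- The coefficients after substituting `⌊x⌋ + 1/Y` in the form and clearing `Y²`; the substitution
  -- is unimodular and keeps the discriminant.
  refine ⟨A * ⌊x⌋ ^ 2 + B * ⌊x⌋ + C, B + 2 * ⌊x⌋ * A, A, ?_, ?_, ?_, ?_⟩
  · rw [← Int.cast_ne_zero (α := ℝ), e4]
    exact mul_ne_zero (mul_ne_zero e3 e1) e2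
  · rw [← hD]
    ring
  · rw [e4, QDeformed.gauss, Int.fract]
    field_simp
    push_cast
    linear_combination h1
  · rw [e4, QDeformed.gauss, Int.fract]
    field_simp

theorem AreConjugate.gauss_neg {D : ℤ} {x x' : ℝ} (h : AreConjugate D x x') (hx : Irrational x)
    (h1 : x' < ⌊x⌋) : ∃ y' < 0, AreConjugate D (QDeformed.gauss x) y' :=
  ⟨_, inv_lt_zero.mpr (sub_neg.mpr h1), h.gauss hx⟩

/-- Distinct irrationals have distinct digits, and up to the first difference `gauss` acts on both
conjugates alike. If the conjugate then has the smaller floor, the next step makes it negative.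
Otherwise the next step sends it below `1`, hence below the next digit, and one further step makes
it negative. -/
theorem AreConjugate.exists_neg {D : ℤ} {x x' : ℝ} (h : AreConjugate D x x') (hx : Irrational x)
    (hne : x ≠ x') : ∃ n y', 1 ≤ n ∧ y' < 0 ∧ AreConjugate D (QDeformed.gauss^[n] x) y' := by
  classical
  have hx' := h.irrational hx
  have hex : ∃ n, digit x n ≠ digit x' n := by
    by_contra! hcon
    exact hne (eq_of_digit_eq hx hx' (funext hcon))
  have hlt : ∀ i < Nat.find hex, digit x i = digit x' i := fun i hi =>
    not_not.mp (Nat.find_min hex hi)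
  have hconj : ∀ i ≤ Nat.find hex,
      AreConjugate D (QDeformed.gauss^[i] x) (QDeformed.gauss^[i] x') := by
    intro i hi
    induction i with
    | zero => exact h
    | succ i ih =>
      have h1 := (ih (by omega)).gauss (irrational_gauss_iterate hx i)
      have h2 : ⌊QDeformed.gauss^[i] x⌋ = ⌊QDeformed.gauss^[i] x'⌋ := hlt i (by omega)
      rw [h2] at h1
      rw [Function.iterate_succ_apply', Function.iterate_succ_apply']
      exact h1
  have hfind := Nat.find_spec hex
  generalize Nat.find hex = n at hconj hfind
  have hc := hconj n le_rfl
  have hy := irrational_gauss_iterate hx n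
  rw [digit, digit] at hfind
  rcases lt_or_gt_of_ne hfind with h1 | h1
  · have h2 : (⌊QDeformed.gauss^[n] x⌋ : ℝ) + 1 ≤ QDeformed.gauss^[n] x' :=
      le_trans (by exact_mod_cast h1) (Int.floor_le _)
    have h3 : (QDeformed.gauss^[n] x' - ⌊QDeformed.gauss^[n] x⌋)⁻¹ ≤ 1 :=
      inv_le_one_of_one_le₀ (by linarith)
    have h4 : (1 : ℝ) ≤ ⌊QDeformed.gauss (QDeformed.gauss^[n] x)⌋ := by
      exact_mod_cast one_le_floor_gauss hy
    have hc' := hc.gauss hy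
    have h5 := (hc'.irrational (irrational_gauss hy)).ne_one
    obtain ⟨y', hy1, hy2⟩ := hc'.gauss_neg (irrational_gauss hy)
      ((lt_of_le_of_ne h3 h5).trans_le h4)
    refine ⟨n + 2, y', by omega, hy1, ?_⟩
    rwa [Function.iterate_succ_apply', Function.iterate_succ_apply']
  · obtain ⟨y', hy1, hy2⟩ := hc.gauss_neg hy (Int.floor_lt.mp h1)
    refine ⟨n + 1, y', by omega, hy1, ?_⟩
    rwa [Function.iterate_succ_apply']

/-- Roots of opposite signs give `A * C < 0`, so `D = B² + 4|A||C|` bounds `|A|` and `|B|`. The root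
is then `(-B ± √D) / (2A)`, so `C` need not be recorded. -/
theorem finite_setOf_areConjugate (D : ℤ) :
    {x : ℝ | 0 < x ∧ ∃ x' < 0, AreConjugate D x x'}.Finite := by
  refine Set.Finite.subset ((((Set.finite_Icc (-D) D).prod (Set.finite_Icc (-D) D)).prod
    (Set.toFinite {√(D : ℝ), -√(D : ℝ)})).image
      fun p : (ℤ × ℤ) × ℝ => (-p.1.2 + p.2) / (2 * p.1.1)) ?_
  rintro x ⟨hx, x', hx', A, B, C, hA, hD, h1, h2⟩
  have hA' : (A : ℝ) ≠ 0 := by exact_mod_cast hA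
  have hAC : A * C < 0 := by
    have : (A * C : ℝ) < 0 := by
      rw [← h2, ← mul_assoc]
      exact mul_neg_of_pos_of_neg (mul_self_pos.mpr hA') (mul_neg_of_pos_of_neg hx hx')
    exact_mod_cast this
  have hC : C ≠ 0 := by rintro rfl; simp at hAC
  have hABC : |A| ≤ D ∧ |B| ≤ D := by
    have h3 : |A| * |C| = -(A * C) := by rw [← abs_mul, abs_of_neg hAC]
    have h4 := Int.one_le_abs hC
    have h5 := abs_nonneg A
    have h6 := abs_nonneg B
    have h7 := sq_abs B
    constructor
    · nlinarith [sq_nonneg B]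
    · nlinarith
  have hsq : (2 * A * x + B) ^ 2 = (D : ℝ) := by
    have : (D : ℝ) = B ^ 2 - 4 * A * C := by exact_mod_cast hD.symm
    rw [this]
    linear_combination (4 * A * x) * h1 - 4 * A * h2
  refine ⟨((A, B), 2 * A * x + B), ⟨⟨abs_le.mp hABC.1, abs_le.mp hABC.2⟩, ?_⟩, ?_⟩
  · rw [Set.mem_insert_iff, Set.mem_singleton_iff, ← hsq, Real.sqrt_sq_eq_abs]
    rcases abs_choice (2 * A * x + B) with h | h <;> rw [h]
    · exact Or.inl rfl
    · exact Or.inr (neg_neg _).symm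
  · simp only
    field_simp
    ring

/-- Once negative, the conjugate stays negative, because all later digits are positive. The orbit
therefore remains in a finite set and the pigeonhole principle applies. -/
theorem AreConjugate.exists_iterate_eq {D : ℤ} {x x' : ℝ} (h : AreConjugate D x x')
    (hx : Irrational x) (hne : x ≠ x') :
    ∃ N t, 1 ≤ N ∧ 0 < t ∧ QDeformed.gauss^[N + t] x = QDeformed.gauss^[N] x := by
  obtain ⟨n, y', hn, hy', hc⟩ := h.exists_neg hx hne
  have hmaps : Set.MapsTo (fun k => QDeformed.gauss^[n + k] x) Set.univ
      {x : ℝ | 0 < x ∧ ∃ x' < 0, AreConjugate D x x'} := by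
    intro k _
    refine ⟨zero_lt_one.trans (one_lt_gauss_iterate hx (by omega)), ?_⟩
    beta_reduce
    induction k with
    | zero => exact ⟨y', hy', hc⟩
    | succ k ih =>
      obtain ⟨z', hz', hz⟩ := ih trivial
      rw [← add_assoc, Function.iterate_succ_apply']
      refine hz.gauss_neg (irrational_gauss_iterate hx _) (hz'.trans ?_)
      have := one_le_floor (one_lt_gauss_iterate hx (n := n + k) (by omega))
      exact_mod_cast (show (0 : ℤ) < _ by omega)
  obtain ⟨i, -, j, -, hij, heq⟩ :=
    Set.infinite_univ.exists_ne_map_eq_of_mapsTo hmaps (finite_setOf_areConjugate D)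
  rcases lt_or_gt_of_ne hij with hlt | hlt
  · refine ⟨n + i, j - i, by omega, by omega, ?_⟩
    rw [show n + i + (j - i) = n + j by omega, heq]
  · refine ⟨n + j, i - j, by omega, by omega, ?_⟩
    rw [show n + j + (i - j) = n + i by omega, heq]

/-! ### Quadratic irrationals and Lagrange's theorem -/

theorem irrational_sqrt_of_not_isSquare {p : ℤ} (hp : 0 < p) (h : ¬ IsSquare p) :
    Irrational √(p : ℝ) := by
  rw [irrational_sqrt_intCast_iff]
  exact ⟨h, hp.le⟩

theorem IsQuadraticIrrational.irrational {x : ℝ} (hx : IsQuadraticIrrational x) :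
    Irrational x := by
  obtain ⟨r, p, s, hp, hs, hsq, h⟩ := hx
  have hi := irrational_sqrt_of_not_isSquare hp hsq
  rcases h with rfl | rfl
  · exact (hi.intCast_add r).div_intCast hs.ne'
  · exact (hi.intCast_sub r).div_intCast hs.ne'

theorem IsQuadraticIrrational.exists_areConjugate {x : ℝ} (hx : IsQuadraticIrrational x) :
    ∃ D x', AreConjugate D x x' ∧ x ≠ x' := by
  obtain ⟨r, p, s, hp, hs, hsq, h⟩ := hx
  have hp' : (0 : ℝ) < p := by exact_mod_cast hp
  have hs' : (s : ℝ) ≠ 0 := by exact_mod_cast hs.ne'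
  have h1 : √(p : ℝ) ^ 2 = p := Real.sq_sqrt hp'.le
  have h2 := Real.sqrt_pos.mpr hp'
  -- Taking `u = ±√p` treats both signs at once; the form is `s²X² - 2rsX + (r² - p)`.
  have key : ∀ u : ℝ, u ^ 2 = p → u ≠ 0 →
      AreConjugate (4 * s ^ 2 * p) ((r + u) / s) ((r - u) / s) ∧ (r + u) / s ≠ (r - u) / s := by
    intro u hu hu0
    refine ⟨⟨s ^ 2, -2 * r * s, r ^ 2 - p, pow_ne_zero _ hs.ne', by ring, ?_, ?_⟩, ?_⟩
    · push_cast
      field_simp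
      ring
    · push_cast
      field_simp
      linear_combination -hu
    · rw [Ne, div_left_inj' hs']
      intro h
      exact hu0 (by linarith)
  rcases h with rfl | rfl
  · exact ⟨_, _, key _ h1 h2.ne'⟩
  · have := key (-√(p : ℝ)) (by rw [neg_sq, h1]) (neg_ne_zero.mpr h2.ne')
    rw [← sub_eq_add_neg] at this
    exact ⟨_, _, this⟩

/-- Lagrange's theorem: the expansion of a quadratic irrational is eventually periodic. -/
theorem IsQuadraticIrrational.exists_iterate_gauss_eq {x : ℝ} (hx : IsQuadraticIrrational x) :
    ∃ N t, 1 ≤ N ∧ 0 < t ∧ gauss^[N + t] x = gauss^[N] x := by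
  obtain ⟨D, x', h, hne⟩ := hx.exists_areConjugate
  exact h.exists_iterate_eq hx.irrational hne

theorem IsRegSeries.hasPeriodicRegExpansion {f : ℝ → ℚ⸨X⸩} (hf : IsRegSeries f) {x : ℝ}
    (hx : IsQuadraticIrrational x) : HasPeriodicRegExpansion x (f x) := by
  obtain ⟨N, t, -, ht, h⟩ := hx.exists_iterate_gauss_eq
  have hi := hx.irrational
  refine ⟨digit x, fun i h1 => one_le_floor (one_lt_gauss_iterate hi h1), ⟨N, t, ht, fun n hn => ?_⟩,
    tendsto_regCF_truncation hi, hf.coeffTendsto_truncation hi⟩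
  rw [digit, digit, iterate_add_eq_of_le h hn]

/-! ### The negative expansion -/

/-- The map sending `⟦c₁, c₂, …⟧` to `⟦c₂, c₃, …⟧`. -/
noncomputable def negGauss (x : ℝ) : ℝ := (⌈x⌉ - x)⁻¹

/-- The digits of the negative continued fraction of `x`. -/
noncomputable def negDigit (x : ℝ) (n : ℕ) : ℤ := ⌈negGauss^[n] x⌉

theorem irrational_negGauss {x : ℝ} (hx : Irrational x) : Irrational (negGauss x) :=
  (hx.intCast_sub _).inv

theorem irrational_negGauss_iterate {x : ℝ} (hx : Irrational x) (n : ℕ) :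
    Irrational (negGauss^[n] x) := by
  induction n with
  | zero => exact hx
  | succ n ih => rw [Function.iterate_succ_apply']; exact irrational_negGauss ih

theorem ceil_eq_floor_add_one {x : ℝ} (hx : Irrational x) : ⌈x⌉ = ⌊x⌋ + 1 := by
  have := fract_pos_of_irrational hx
  rw [Int.fract] at this
  rw [Int.ceil_eq_iff]
  push_cast
  exact ⟨by linarith, (Int.lt_floor_add_one x).le⟩

theorem one_lt_negGauss {x : ℝ} (hx : Irrational x) : 1 < negGauss x := by
  have := fract_pos_of_irrational hx
  have h2 := Int.lt_floor_add_one x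
  rw [Int.fract] at this
  rw [negGauss, ceil_eq_floor_add_one hx]
  push_cast
  exact (one_lt_inv₀ (by linarith)).mpr (by linarith)

theorem ceil_sub_inv_negGauss (x : ℝ) : (⌈x⌉ : ℝ) - (negGauss x)⁻¹ = x := by
  rw [negGauss, inv_inv, sub_sub_cancel]

theorem two_le_ceil {x : ℝ} (hx : 1 < x) : 2 ≤ ⌈x⌉ := by
  have : 1 < ⌈x⌉ := Int.lt_ceil.mpr (by simpa using hx)
  omega

theorem negGauss_add_one (x : ℝ) : negGauss (x + 1) = negGauss x := by
  rw [negGauss, negGauss, Int.ceil_add_one]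
  push_cast
  ring

theorem gauss_add_one (x : ℝ) : gauss (x + 1) = gauss x := by
  rw [gauss, gauss, Int.fract_add_one]

theorem gauss_sub_one (x : ℝ) : gauss (x - 1) = gauss x := by
  rw [gauss, gauss, Int.fract_sub_one]

theorem negGauss_eq {x : ℝ} (hx : Irrational x) : negGauss x = 1 + (gauss x - 1)⁻¹ := by
  have h1 := one_lt_gauss hx
  have h2 := floor_add_inv_gauss x
  have h3 : (⌈x⌉ : ℝ) - x = 1 - (gauss x)⁻¹ := by
    rw [ceil_eq_floor_add_one hx]
    push_cast
    linarith
  have h4 : gauss x - 1 ≠ 0 := by linarith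
  rw [negGauss, h3]
  field_simp
  ring

theorem negGauss_of_floor_gauss_eq_one {x : ℝ} (hx : Irrational x) (h : ⌊gauss x⌋ = 1) :
    negGauss x = gauss (gauss x) + 1 := by
  have h1 := floor_add_inv_gauss (gauss x)
  have h2 : gauss x - 1 = (gauss (gauss x))⁻¹ := by
    rw [h] at h1
    push_cast at h1
    linarith
  rw [negGauss_eq hx, h2, inv_inv, add_comm]

theorem floor_negGauss {x : ℝ} (hx : Irrational x) (h : 2 ≤ ⌊gauss x⌋) :
    ⌊negGauss x⌋ = 1 ∧ gauss (negGauss x) = gauss x - 1 := by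
  have h1 : (2 : ℝ) < gauss x := by
    refine lt_of_le_of_ne (Int.le_floor.mp h) fun h0 => irrational_gauss hx ⟨2, by simpa using h0⟩
  have h2 : ⌊negGauss x⌋ = 1 := by
    rw [negGauss_eq hx, Int.floor_eq_iff]
    have h3 : (gauss x - 1)⁻¹ < 1 := inv_lt_one_of_one_lt₀ (by linarith)
    have h4 : 0 < (gauss x - 1)⁻¹ := inv_pos.mpr (by linarith)
    push_cast
    constructor <;> linarith
  refine ⟨h2, ?_⟩
  rw [gauss, Int.fract, h2, negGauss_eq hx]
  push_cast
  rw [add_sub_cancel_left, inv_inv]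

/-- The classical conversion of digits: the first `b` iterations each lower the regular digit `b +
1` by one (producing negative digits `2` after the first one), and the last iteration removes the
remaining `1`. -/
theorem negGauss_iterate_of_floor_gauss_eq (b : ℕ) {x : ℝ} (hx : Irrational x)
    (h : ⌊gauss x⌋ = b + 1) : negGauss^[b + 1] x = gauss (gauss x) + 1 := by
  induction b generalizing x with
  | zero => exact negGauss_of_floor_gauss_eq_one hx (by simpa using h)
  | succ b ih =>
    push_cast at h
    obtain ⟨-, h2⟩ := floor_negGauss hx (by omega)
    rw [Function.iterate_succ_apply, ih (irrational_negGauss hx), h2, gauss_sub_one]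
    rw [h2, Int.floor_sub_one, h]
    ring

theorem negGauss_iterate_add_one {m : ℕ} (hm : 1 ≤ m) (x : ℝ) :
    negGauss^[m] (x + 1) = negGauss^[m] x := by
  obtain ⟨m, rfl⟩ := Nat.exists_eq_add_of_le' hm
  rw [Function.iterate_succ_apply, negGauss_add_one, Function.iterate_succ_apply]

theorem exists_negGauss_iterate_eq (k : ℕ) {x : ℝ} (hx : Irrational x) :
    ∃ m, k < m ∧ negGauss^[m] x = gauss^[2 * (k + 1)] x + 1 := by
  have key : ∀ y, Irrational y → ∃ m, 1 ≤ m ∧ negGauss^[m] y = gauss (gauss y) + 1 := by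
    intro y hy
    have h1 := one_le_floor_gauss hy
    refine ⟨(⌊gauss y⌋ - 1).toNat + 1, by omega, negGauss_iterate_of_floor_gauss_eq _ hy (by omega)⟩
  induction k with
  | zero =>
    obtain ⟨m, h1, h2⟩ := key x hx
    exact ⟨m, h1, h2⟩
  | succ k ih =>
    obtain ⟨m, h1, h2⟩ := ih
    obtain ⟨n, h3, h4⟩ := key _ (irrational_gauss_iterate hx (2 * (k + 1)))
    refine ⟨n + m, by omega, ?_⟩
    rw [Function.iterate_add_apply, h2, negGauss_iterate_add_one h3, h4,
      show 2 * (k + 1 + 1) = 2 * (k + 1) + 1 + 1 by ring, Function.iterate_succ_apply',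
      Function.iterate_succ_apply']

/-! ### Periodicity and convergence of the negative expansion -/

theorem exists_iterate_negGauss_eq {x : ℝ} (hx : Irrational x) {N t : ℕ} (ht : 0 < t)
    (h : gauss^[N + t] x = gauss^[N] x) :
    ∃ M s, 0 < s ∧ negGauss^[M + s] x = negGauss^[M] x := by
  obtain ⟨M, -, hM⟩ := exists_negGauss_iterate_eq N hx
  obtain ⟨k, rfl⟩ : ∃ k, t = k + 1 := ⟨t - 1, by omega⟩
  obtain ⟨s, hs, hs'⟩ := exists_negGauss_iterate_eq k
    (irrational_gauss_iterate hx (2 * (N + 1)))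
  refine ⟨M, s, by omega, ?_⟩
  -- The conversion reaches only even iterates of `gauss`, so the period `k + 1` is used twice.
  rw [add_comm, Function.iterate_add_apply, hM, negGauss_iterate_add_one (by omega), hs',
    ← Function.iterate_add_apply,
    show 2 * (k + 1) + 2 * (N + 1) = 2 * (N + 1) + (k + 1) + (k + 1) by ring,
    iterate_add_eq_of_le h (by omega), iterate_add_eq_of_le h (by omega)]

/-- Periodicity leaves finitely many values, each above `1`, so their minimum is a uniform bound. It
supplies the geometric rate that digits `≥ 2` alone do not give. -/
theorem exists_one_lt_forall_le_negGauss_iterate {x : ℝ} (hx : Irrational x) {M s : ℕ}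
    (hs : 0 < s) (h : negGauss^[M + s] x = negGauss^[M] x) :
    ∃ δ : ℝ, 1 < δ ∧ ∀ n, 1 ≤ n → δ ≤ negGauss^[n] x := by
  have hgt : ∀ n, 1 ≤ n → 1 < negGauss^[n] x := by
    intro n hn
    obtain ⟨n, rfl⟩ := Nat.exists_eq_add_of_le' hn
    rw [Function.iterate_succ_apply']
    exact one_lt_negGauss (irrational_negGauss_iterate hx n)
  obtain ⟨i, hi, hmin⟩ := (Finset.Icc 1 (M + s)).exists_min_image (fun n => negGauss^[n] x)
    ⟨1, by simp; omega⟩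
  refine ⟨_, hgt i (Finset.mem_Icc.mp hi).1, fun n hn => ?_⟩
  induction n using Nat.strong_induction_on with
  | _ n ih =>
    rcases le_or_gt n (M + s) with h1 | h1
    · exact hmin n (Finset.mem_Icc.mpr ⟨hn, h1⟩)
    · have h2 := iterate_add_eq_of_le h (n := n - s) (by omega)
      rw [show n - s + s = n by omega] at h2
      rw [h2]
      exact ih _ (by omega) (by omega)

theorem truncation_negDigit_succ (x : ℝ) (n : ℕ) :
    truncation (negDigit x) (n + 1) = ⌈x⌉ :: truncation (negDigit (negGauss x)) n := by
  rw [truncation_succ]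
  rfl

theorem negCF_cons (c : ℤ) {l : List ℤ} (hl : l ≠ []) :
    (negCF (c :: l) : ℝ) = c - (negCF l)⁻¹ := by
  obtain ⟨b, l, rfl⟩ := List.exists_cons_of_ne_nil hl
  rw [negCF, one_div]

theorem negCF_truncation_negDigit (x : ℝ) (n : ℕ) :
    (negCF (truncation (negDigit x) (n + 2)) : ℝ) =
      ⌈x⌉ - (negCF (truncation (negDigit (negGauss x)) (n + 1)))⁻¹ := by
  rw [truncation_negDigit_succ, negCF_cons _ (truncation_ne_nil _ _)]

/-- Truncations overshoot: with `y = negGauss x` and `T` the truncation of `y`, one has `T ≥ y ≥ δ`,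
and the step divides the error by `T * y ≥ δ`. -/
theorem negCF_truncation_bounds {δ : ℝ} (hδ : 1 < δ) (n : ℕ) {x : ℝ}
    (h : ∀ i, 1 ≤ i → δ ≤ negGauss^[i] x) :
    x ≤ negCF (truncation (negDigit x) (n + 1)) ∧
      negCF (truncation (negDigit x) (n + 1)) - x ≤ δ⁻¹ ^ n := by
  induction n generalizing x with
  | zero =>
    simp only [zero_add, truncation, List.range_one, List.map_cons, List.map_nil, negCF, negDigit,
      Function.iterate_zero, id, pow_zero]
    have := Int.le_ceil x
    have := Int.ceil_lt_add_one x
    constructor <;> linarith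
  | succ n ih =>
    obtain ⟨h1, h2⟩ := ih (x := negGauss x) fun i hi => h (i + 1) (by omega)
    have h3 : δ ≤ negGauss x := h 1 le_rfl
    rw [negCF_truncation_negDigit]
    have h5 := ceil_sub_inv_negGauss x
    generalize (negCF (truncation (negDigit (negGauss x)) (n + 1)) : ℝ) = T at *
    generalize negGauss x = y at *
    have h6 : 0 < y := by linarith
    have h7 : 0 < T := by linarith
    have h8 : (⌈x⌉ : ℝ) - T⁻¹ - x = (T - y) / (T * y) := by
      rw [show (⌈x⌉ : ℝ) - T⁻¹ - x = y⁻¹ - T⁻¹ by linarith]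
      field_simp
    have h9 : 0 ≤ (T - y) / (T * y) := div_nonneg (by linarith) (by positivity)
    refine ⟨by linarith, ?_⟩
    rw [h8, pow_succ, ← div_eq_mul_inv]
    exact div_le_div₀ (by positivity) h2 (by linarith) (by nlinarith)

theorem tendsto_negCF_truncation {δ : ℝ} (hδ : 1 < δ) {x : ℝ}
    (h : ∀ i, 1 ≤ i → δ ≤ negGauss^[i] x) :
    Tendsto (fun n => (negCF (truncation (negDigit x) n) : ℝ)) atTop (𝓝 x) := by
  rw [← tendsto_add_atTop_iff_nat 1, tendsto_iff_dist_tendsto_zero]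
  refine squeeze_zero (fun _ => dist_nonneg) (fun n => ?_)
    (tendsto_pow_atTop_nhds_zero_of_lt_one (r := δ⁻¹) (by positivity) (inv_lt_one_of_one_lt₀ hδ))
  obtain ⟨h1, h2⟩ := negCF_truncation_bounds hδ n h
  rwa [Real.dist_eq, abs_of_nonneg (sub_nonneg.mpr h1)]

/-! ### The `q`-deformed negative expansion -/

/-- The `q`-analogue of `a + 1/(b + 1/Z) = (a + 1) - 1/(1 + 1/((b - 1) + 1/Z))`. -/
theorem qInt_sub_div_qStep_one {K : Type*} [Field K] {q : K} (h0 : q ≠ 0) (h1 : q ≠ 1) (a b : ℤ)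
    {Z : K} (hb : 1 + q * qInt q b * Z ≠ 0) (hb' : 1 + q * qInt q (b - 1) * Z ≠ 0) :
    qInt q (a + 1) - q ^ a / qStep q 1 (b - 1) Z = qStep q a b Z := by
  have e1 : qInt q (a + 1) = qInt q a + q ^ a := by
    rw [qInt_add h0 h1, qInt_one h1, mul_one]
  have e2 : q * qInt q b = q * qInt q (b - 1) + q ^ b := by
    have := qInt_add h0 h1 (b - 1) 1
    rw [sub_add_cancel, qInt_one h1, mul_one] at this
    rw [this, zpow_sub_one₀ h0]
    field_simp
  have e3 : qStep q 1 (b - 1) Z = (1 + q * qInt q b * Z) / (1 + q * qInt q (b - 1) * Z) := by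
    rw [qStep, qInt_one h1, add_sub_cancel, e2, eq_div_iff hb', add_mul, div_mul_cancel₀ _ hb']
    ring
  rw [e1, e3, qStep, zpow_add₀ h0, add_sub_assoc]
  congr 1
  rw [div_div_eq_mul_div, eq_div_iff hb, sub_mul, div_mul_cancel₀ _ hb, e2]
  ring

theorem IsRegSeries.apply_add_one (hf : IsRegSeries f) {x : ℝ} (hx : Irrational x) :
    f (x + 1) = qVar * f x + 1 := by
  have hx1 : Irrational (x + 1) := by simpa using hx.add_intCast 1
  rw [(hf _ hx1).1, (hf _ hx).1, Int.floor_add_one, gauss_add_one,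
    qStep_add_one qVar_ne_zero qVar_ne_one]

theorem IsRegSeries.eq_negStep (hf : IsRegSeries f) {x : ℝ} (hx : Irrational x) :
    f x = qInt qVar ⌈x⌉ - qVar ^ (⌈x⌉ - 1) / f (negGauss x) := by
  have hg := irrational_gauss hx
  have hb := one_le_floor_gauss hx
  have hZ := hf.isOneUnit_gauss hg
  rw [ceil_eq_floor_add_one hx, add_sub_cancel_right, (hf x hx).1]
  have hd := (isOneUnit_qStep_denominator hb hZ).ne_zero
  -- If the digit is `1`, then `b - 1 = 0` is no regular digit; instead `qStep q 1 0 Z = 1 + q Z` is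
  -- the value of `f` at `gauss (gauss x) + 1`.
  rcases hb.eq_or_lt with h1 | h1
  · rw [negGauss_of_floor_gauss_eq_one hx h1.symm, hf.apply_add_one (irrational_gauss hg),
      ← qInt_sub_div_qStep_one qVar_ne_zero qVar_ne_one _ _ hd
        (by rw [← h1]; simp [qInt_zero]), ← h1]
    simp [qStep, qInt_zero, qInt_one qVar_ne_one, add_comm]
  · obtain ⟨h2, h3⟩ := floor_negGauss hx h1
    rw [(hf _ (irrational_negGauss hx)).1, h2, h3, Int.floor_sub_one, gauss_sub_one,
      qInt_sub_div_qStep_one qVar_ne_zero qVar_ne_one _ _ hd]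
    exact (isOneUnit_qStep_denominator (by omega) hZ).ne_zero

theorem qNegCF_cons {K : Type*} [Field K] (q : K) (c : ℤ) {l : List ℤ} (hl : l ≠ []) :
    qNegCF q (c :: l) = qInt q c - q ^ (c - 1) / qNegCF q l := by
  obtain ⟨b, l, rfl⟩ := List.exists_cons_of_ne_nil hl
  rw [qNegCF]

theorem qNegCF_truncation_isOneUnit (n : ℕ) {x : ℝ} (hx : Irrational x) (h1 : 1 < x) :
    IsOneUnit (qNegCF qVar (truncation (negDigit x) (n + 1))) := by
  induction n generalizing x with
  | zero =>
    have := two_le_ceil h1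
    simpa [truncation, qNegCF, negDigit] using qInt_isOneUnit (show 1 ≤ ⌈x⌉ by omega)
  | succ n ih =>
    rw [truncation_negDigit_succ, qNegCF_cons _ _ (truncation_ne_nil _ _)]
    exact qNegStep_isOneUnit (two_le_ceil h1) (ih (irrational_negGauss hx) (one_lt_negGauss hx))

theorem IsRegSeries.negTruncation_sub_mem_of_one_lt (hf : IsRegSeries f) (n : ℕ) {x : ℝ}
    (hx : Irrational x) (h1 : 1 < x) :
    qNegCF qVar (truncation (negDigit x) (n + 1)) - f x ∈ qPow n := by
  induction n generalizing x with
  | zero => exact sub_mem (qNegCF_truncation_isOneUnit 0 hx h1).mem ((hf x hx).2 h1).mem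
  | succ n ih =>
    have h2 := irrational_negGauss hx
    have h3 := one_lt_negGauss hx
    rw [truncation_negDigit_succ, qNegCF_cons _ _ (truncation_ne_nil _ _), hf.eq_negStep hx]
    have := two_le_ceil h1
    exact qPow_anti (by push_cast; omega) (qNegStep_sub_mem (qNegCF_truncation_isOneUnit n h2 h3)
      ((hf _ h2).2 h3) (ih h2 h3) _)

theorem IsRegSeries.coeffTendsto_negTruncation (hf : IsRegSeries f) {x : ℝ} (hx : Irrational x) :
    CoeffTendsto (fun n => qNegCF qVar (truncation (negDigit x) n)) (f x) := by
  refine coeffTendsto_of_eventually fun k => ?_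
  have h2 := irrational_negGauss hx
  have h3 := one_lt_negGauss hx
  filter_upwards [eventually_ge_atTop ((k - ⌈x⌉ + 1).toNat + 2)] with m hm
  obtain ⟨n, rfl⟩ := Nat.exists_eq_add_of_le' (show 2 ≤ m by omega)
  rw [truncation_negDigit_succ, qNegCF_cons _ _ (truncation_ne_nil _ _), hf.eq_negStep hx]
  exact qPow_anti (by omega) (qNegStep_sub_mem (qNegCF_truncation_isOneUnit n h2 h3)
    ((hf _ h2).2 h3) (hf.negTruncation_sub_mem_of_one_lt n h2 h3) _)

theorem IsRegSeries.hasPeriodicNegExpansion (hf : IsRegSeries f) {x : ℝ}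
    (hx : IsQuadraticIrrational x) : HasPeriodicNegExpansion x (f x) := by
  obtain ⟨N, t, -, ht, h⟩ := hx.exists_iterate_gauss_eq
  have hi := hx.irrational
  obtain ⟨M, s, hs, h⟩ := exists_iterate_negGauss_eq hi ht h
  obtain ⟨δ, hδ, hmin⟩ := exists_one_lt_forall_le_negGauss_iterate hi hs h
  refine ⟨negDigit x, fun i h1 => two_le_ceil (hδ.trans_le (hmin i h1)), ⟨M, s, hs, fun n hn => ?_⟩,
    tendsto_negCF_truncation hδ hmin, hf.coeffTendsto_negTruncation hi⟩
  rw [negDigit, negDigit, iterate_add_eq_of_le h hn]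

open Matrix

/-! ### The matrices of the expansion -/

/-- Invertibility of `g` runs the recursion downwards too, which covers a negative first digit
without computing inverse matrices. -/
theorem zpow_mulVec_eq {R n : Type*} [CommRing R] [Fintype n] [DecidableEq n]
    (g : GeneralLinearGroup n R) {w : ℤ → n → R} (h : ∀ a, g.val *ᵥ w a = w (a + 1)) (a : ℤ) :
    (g ^ a).val *ᵥ w 0 = w a := by
  induction a using Int.induction_on with
  | zero => simp
  | succ k ih =>
    rw [add_comm, _root_.zpow_add, zpow_one, Units.val_mul, ← mulVec_mulVec, ih, h, add_comm]
  | pred k ih =>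
    rw [sub_eq_neg_add, _root_.zpow_add, _root_.zpow_neg_one, Units.val_mul, ← mulVec_mulVec, ih,
      neg_add_eq_sub]
    have := h (-k - 1)
    rw [sub_add_cancel] at this
    rw [← this, mulVec_mulVec, ← Units.val_mul, inv_mul_cancel, Units.val_one, one_mulVec]

/-- The matrix of `[x]_q ↦ [x + 1]_q`. -/
noncomputable def genR : GeneralLinearGroup (Fin 2) ℤ[T;T⁻¹] :=
  GeneralLinearGroup.mk'' !![T 1, 1; 0, 1] (by simp [det_fin_two, isUnit_T])

/-- The matrix of `[x]_q ↦ [x / (x + 1)]_q`. -/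
noncomputable def genL : GeneralLinearGroup (Fin 2) ℤ[T;T⁻¹] :=
  GeneralLinearGroup.mk'' !![T 1, 0; T 1, 1] (by simp [det_fin_two, isUnit_T])

theorem val_genR : genR.val = !![T 1, 1; 0, 1] := rfl

theorem val_genL : genL.val = !![T 1, 0; T 1, 1] := rfl

/-- The matrix of the first `2 * k` digits of `x`. -/
noncomputable def expansionMatrix : ℕ → ℝ → GeneralLinearGroup (Fin 2) ℤ[T;T⁻¹]
  | 0, _ => 1
  | k + 1, x => genR ^ ⌊x⌋ * genL ^ ⌊gauss x⌋ * expansionMatrix k (gauss (gauss x))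

/-! ### Action of the expansion matrices under a specialization of `q` -/

section specialization

variable {K : Type*} [Field K] (ρ : ℤ[T;T⁻¹] →+* K)

theorem map_T_one_ne_zero : ρ (T 1) ≠ 0 := ((isUnit_T 1).map ρ).ne_zero

/-- The function `br` gives the `u`-integers, for every `u ≠ 0`. -/
def IsBracket (u : K) (br : ℤ → K) : Prop :=
  br 0 = 0 ∧ ∀ a, br (a + 1) = u * br a + 1 ∧ br (a + 1) = br a + u ^ a

variable {ρ} {br : ℤ → K}

theorem map_genR_zpow_mulVec (hbr : IsBracket (ρ (T 1)) br) (a : ℤ) (Z W : K) :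
    (GeneralLinearGroup.map ρ (genR ^ a)).val *ᵥ ![Z, W] =
      ![ρ (T 1) ^ a * Z + br a * W, W] := by
  rw [map_zpow]
  have := zpow_mulVec_eq (GeneralLinearGroup.map ρ genR)
    (w := fun a => ![ρ (T 1) ^ a * Z + br a * W, W]) (fun a => ?_) a
  · simpa [hbr.1] using this
  · have h : (GeneralLinearGroup.map ρ genR).val = !![ρ (T 1), 1; 0, 1] := by
      ext i j
      fin_cases i <;> fin_cases j <;> simp [val_genR]
    rw [h, (hbr.2 a).1, zpow_add_one₀ (map_T_one_ne_zero ρ)]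
    ext i
    fin_cases i
    · simp [mulVec, dotProduct, Fin.sum_univ_two]
      ring
    · simp [mulVec, dotProduct, Fin.sum_univ_two]

theorem map_genL_zpow_mulVec (hbr : IsBracket (ρ (T 1)) br) (b : ℤ) (Z W : K) :
    (GeneralLinearGroup.map ρ (genL ^ b)).val *ᵥ ![Z, W] =
      ![ρ (T 1) ^ b * Z, ρ (T 1) * br b * Z + W] := by
  rw [map_zpow]
  have := zpow_mulVec_eq (GeneralLinearGroup.map ρ genL)
    (w := fun b => ![ρ (T 1) ^ b * Z, ρ (T 1) * br b * Z + W]) (fun b => ?_) b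
  · simpa [hbr.1] using this
  · have h : (GeneralLinearGroup.map ρ genL).val = !![ρ (T 1), 0; ρ (T 1), 1] := by
      ext i j
      fin_cases i <;> fin_cases j <;> simp [val_genL]
    rw [h, (hbr.2 b).2, zpow_add_one₀ (map_T_one_ne_zero ρ)]
    ext i
    fin_cases i
    · simp [mulVec, dotProduct, Fin.sum_univ_two]
      ring
    · simp [mulVec, dotProduct, Fin.sum_univ_two]
      ring

/-- Each step is the Möbius action of `R^a L^b`, and `c` collects the denominators. The target field
is arbitrary so as to include `q = 1`, where the quotient defining `qInt` degenerates but the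
recursions of `IsBracket` survive. -/
theorem map_expansionMatrix_mulVec (hbr : IsBracket (ρ (T 1)) br) {f : ℝ → K}
    (hf : ∀ x, Irrational x → 1 + ρ (T 1) * br ⌊gauss x⌋ * f (gauss (gauss x)) ≠ 0 ∧
      f x = br ⌊x⌋ + ρ (T 1) ^ (⌊x⌋ + ⌊gauss x⌋) * f (gauss (gauss x)) /
        (1 + ρ (T 1) * br ⌊gauss x⌋ * f (gauss (gauss x))))
    (k : ℕ) {x : ℝ} (hx : Irrational x) :
    ∃ c : K, c ≠ 0 ∧ (GeneralLinearGroup.map ρ (expansionMatrix k x)).val *ᵥ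
      ![f (gauss^[2 * k] x), 1] = c • ![f x, 1] := by
  induction k generalizing x with
  | zero => exact ⟨1, one_ne_zero, by simp [expansionMatrix]⟩
  | succ k ih =>
    obtain ⟨c, hc, h⟩ := ih (irrational_gauss (irrational_gauss hx))
    obtain ⟨h1, h2⟩ := hf x hx
    refine ⟨c * (1 + ρ (T 1) * br ⌊gauss x⌋ * f (gauss (gauss x))), mul_ne_zero hc h1, ?_⟩
    rw [show 2 * (k + 1) = 2 * k + 1 + 1 by ring, Function.iterate_succ_apply,
      Function.iterate_succ_apply, expansionMatrix, map_mul, map_mul, Units.val_mul, Units.val_mul,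
      ← mulVec_mulVec, h, mulVec_smul, ← mulVec_mulVec, map_genL_zpow_mulVec hbr,
      map_genR_zpow_mulVec hbr, mul_smul]
    congr 1
    rw [h2, zpow_add₀ (map_T_one_ne_zero ρ)]
    generalize f (gauss (gauss x)) = Z at *
    ext i
    fin_cases i
    · simp only [Fin.zero_eta, cons_val_zero, Pi.smul_apply, smul_eq_mul]
      rw [mul_add (1 + _), mul_div_cancel₀ _ h1]
      ring
    · simp [add_comm]

end specialization

theorem laurentToSeries_T (n : ℤ) : laurentToSeries (T n) = qVar ^ n := by
  rw [laurentToSeries, LaurentPolynomial.eval₂_T]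
  simp

theorem isBracket_qInt : IsBracket (laurentToSeries (T 1)) (qInt qVar) := by
  rw [laurentToSeries_T, zpow_one]
  refine ⟨qInt_zero, fun a => ⟨qInt_add_one qVar_ne_zero qVar_ne_one a, ?_⟩⟩
  rw [qInt_add qVar_ne_zero qVar_ne_one, qInt_one qVar_ne_one, mul_one]

theorem IsRegSeries.map_expansionMatrix_mulVec {f : ℝ → ℚ⸨X⸩} (hf : IsRegSeries f) (k : ℕ) {x : ℝ}
    (hx : Irrational x) :
    ∃ c : ℚ⸨X⸩, c ≠ 0 ∧ (GeneralLinearGroup.map laurentToSeries (expansionMatrix k x)).val *ᵥ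
      ![f (gauss^[2 * k] x), 1] = c • ![f x, 1] := by
  refine QDeformed.map_expansionMatrix_mulVec isBracket_qInt (fun x hx => ?_) k hx
  have hg := irrational_gauss hx
  rw [laurentToSeries_T, zpow_one]
  exact ⟨(isOneUnit_qStep_denominator (one_le_floor_gauss hx) (hf.isOneUnit_gauss hg)).ne_zero,
    (hf x hx).1⟩

/-! ### Specialization at `q = 1` -/

/-- The value of a Laurent polynomial at `q = 1`. -/
noncomputable def evalOne : ℤ[T;T⁻¹] →+* ℤ := LaurentPolynomial.eval₂ (RingHom.id ℤ) 1

/-- The value of a Laurent polynomial at `q = 1`, as a real number. -/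
noncomputable def evalOneReal : ℤ[T;T⁻¹] →+* ℝ := (Int.castRingHom ℝ).comp evalOne

theorem evalOneReal_apply (p : ℤ[T;T⁻¹]) : evalOneReal p = (evalOne p : ℝ) := rfl

theorem evalOne_T (n : ℤ) : evalOne (T n) = 1 := by
  rw [evalOne, LaurentPolynomial.eval₂_T]
  simp

theorem evalOneReal_T (n : ℤ) : evalOneReal (T n) = 1 := by
  rw [evalOneReal_apply, evalOne_T, Int.cast_one]

theorem isBracket_intCast : IsBracket (evalOneReal (T 1)) (fun a => (a : ℝ)) := by
  rw [evalOneReal_T]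
  exact ⟨by simp, fun a => ⟨by simp, by simp⟩⟩

theorem evalOneReal_expansionMatrix_mulVec (k : ℕ) {x : ℝ} (hx : Irrational x) :
    ∃ c : ℝ, c ≠ 0 ∧ (GeneralLinearGroup.map evalOneReal (expansionMatrix k x)).val *ᵥ
      ![gauss^[2 * k] x, 1] = c • ![x, 1] := by
  refine map_expansionMatrix_mulVec isBracket_intCast (f := fun x => x) (fun x hx => ?_) k hx
  have hg := irrational_gauss hx
  have h1 : (1 : ℝ) ≤ ⌊gauss x⌋ := by exact_mod_cast one_le_floor_gauss hx
  have h2 := one_lt_gauss hg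
  have h3 : 0 < 1 + 1 * (⌊gauss x⌋ : ℝ) * gauss (gauss x) := by nlinarith
  rw [evalOneReal_T]
  refine ⟨h3.ne', ?_⟩
  rw [_root_.one_zpow]
  have h4 := floor_add_inv_gauss (gauss x)
  have h5 := floor_add_inv_gauss x
  have h6 : (gauss x)⁻¹ = 1 * gauss (gauss x) / (1 + 1 * (⌊gauss x⌋ : ℝ) * gauss (gauss x)) := by
    have h7 : (⌊gauss x⌋ : ℝ) + (gauss (gauss x))⁻¹ =
        (1 + 1 * (⌊gauss x⌋ : ℝ) * gauss (gauss x)) / gauss (gauss x) := by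
      field_simp
      ring
    rw [one_mul (gauss _), ← inv_div]
    exact congrArg _ (h4.symm.trans h7)
  rw [← h6, h5]

theorem evalOneReal_expansionMatrix_pos (k : ℕ) {x : ℝ} (hx : Irrational x) (h1 : 1 < x) :
    ∃ p r : ℝ, 0 < p ∧ 0 < r ∧
      (GeneralLinearGroup.map evalOneReal (expansionMatrix (k + 1) x)).val *ᵥ ![1, 0] = ![p, r] := by
  -- The empty product is the identity, with `r = 0`; strict positivity begins at `k = 1`.
  have key : ∀ k : ℕ, ∀ x, Irrational x → 1 < x → ∃ p r : ℝ, 0 < p ∧ 0 ≤ r ∧ (1 ≤ k → 0 < r) ∧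
      (GeneralLinearGroup.map evalOneReal (expansionMatrix k x)).val *ᵥ ![1, 0] = ![p, r] := by
    intro k
    induction k with
    | zero => exact fun x _ _ => ⟨1, 0, one_pos, le_rfl, by simp, by simp [expansionMatrix]⟩
    | succ k ih =>
      intro x hx h1
      have hg := irrational_gauss hx
      obtain ⟨p, r, hp, hr, -, h⟩ := ih _ (irrational_gauss hg) (one_lt_gauss hg)
      have h2 : (0 : ℝ) < ⌊gauss x⌋ := by
        exact_mod_cast (one_le_floor_gauss hx)
      have h3 : (0 : ℝ) < ⌊x⌋ := by exact_mod_cast one_le_floor h1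
      refine ⟨_, _, ?_, ?_, ?_, by
        rw [expansionMatrix, map_mul, map_mul, Units.val_mul, Units.val_mul,
          ← mulVec_mulVec, h, ← mulVec_mulVec, map_genL_zpow_mulVec isBracket_intCast,
          map_genR_zpow_mulVec isBracket_intCast]⟩
      · rw [evalOneReal_T]; positivity
      · rw [evalOneReal_T]; positivity
      · intro _; rw [evalOneReal_T]; positivity
  obtain ⟨p, r, hp, -, hr, h⟩ := key (k + 1) x hx h1
  exact ⟨p, r, hp, hr (by omega), h⟩

/-! ### The symmetry under `q ↦ q⁻¹` -/

/-- The matrix intertwining the matrices of the expansion with their images under `q ↦ q⁻¹`. -/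
noncomputable def barIntertwiner : Matrix (Fin 2) (Fin 2) ℤ[T;T⁻¹] :=
  !![T 1, 1 - T 1; T 1 - 1, 1]

/-- The determinant of `A` is a power of `q`, and `A` is conjugate to `det A` times its image under
`q ↦ q⁻¹`. -/
def IsBarSymmetric (A : Matrix (Fin 2) (Fin 2) ℤ[T;T⁻¹]) : Prop :=
  ∃ n : ℤ, A.det = T n ∧
    (T n : ℤ[T;T⁻¹]) • (A.map (invert (R := ℤ)) * barIntertwiner) = barIntertwiner * A

theorem isBarSymmetric_one : IsBarSymmetric 1 :=
  ⟨0, by simp, by simp⟩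

theorem IsBarSymmetric.mul {A B : Matrix (Fin 2) (Fin 2) ℤ[T;T⁻¹]} (hA : IsBarSymmetric A)
    (hB : IsBarSymmetric B) : IsBarSymmetric (A * B) := by
  obtain ⟨m, h1, h2⟩ := hA
  obtain ⟨n, h3, h4⟩ := hB
  refine ⟨m + n, by rw [det_mul, h1, h3, T_add], ?_⟩
  rw [Matrix.map_mul, ← mul_assoc, ← h2, smul_mul_assoc, mul_assoc, mul_assoc, ← h4,
    mul_smul_comm, smul_smul, T_add]

theorem IsBarSymmetric.pow {A : Matrix (Fin 2) (Fin 2) ℤ[T;T⁻¹]} (hA : IsBarSymmetric A) (n : ℕ) :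
    IsBarSymmetric (A ^ n) := by
  induction n with
  | zero => rw [pow_zero]; exact isBarSymmetric_one
  | succ n ih => rw [pow_succ]; exact ih.mul hA

theorem T_one_mul_T_neg_one : (T 1 * T (-1) : ℤ[T;T⁻¹]) = 1 := by
  rw [← T_add, add_neg_cancel, T_zero]

theorem isBarSymmetric_genR : IsBarSymmetric genR.val := by
  refine ⟨1, by simp [val_genR, det_fin_two], ?_⟩
  have h := T_one_mul_T_neg_one
  have hbar : genR.val.map (invert (R := ℤ)) = !![T (-1), 1; 0, 1] := by
    ext1 i j
    fin_cases i <;> fin_cases j <;> simp [val_genR]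
  rw [hbar, val_genR, barIntertwiner]
  generalize (T 1 : ℤ[T;T⁻¹]) = t at *
  generalize (T (-1) : ℤ[T;T⁻¹]) = s at *
  ext1 i j
  fin_cases i <;> fin_cases j <;> simp [mul_apply, Fin.sum_univ_two, -mul_eq_mul_left_iff]
  · linear_combination t * h
  · linear_combination (1 - t) * h
  · ring

theorem isBarSymmetric_genL : IsBarSymmetric genL.val := by
  refine ⟨1, by simp [val_genL, det_fin_two], ?_⟩
  have h := T_one_mul_T_neg_one
  have hbar : genL.val.map (invert (R := ℤ)) = !![T (-1), 0; T (-1), 1] := by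
    ext1 i j
    fin_cases i <;> fin_cases j <;> simp [val_genL]
  rw [hbar, val_genL, barIntertwiner]
  generalize (T 1 : ℤ[T;T⁻¹]) = t at *
  generalize (T (-1) : ℤ[T;T⁻¹]) = s at *
  ext1 i j
  fin_cases i <;> fin_cases j <;> simp [mul_apply, Fin.sum_univ_two, -mul_eq_mul_left_iff]
  · linear_combination t * h
  · linear_combination (1 - t) * h
  · linear_combination t * h
  · linear_combination (1 - t) * h

/-- For `x > 1` all digits are positive, so the matrix lies in the monoid generated by `genR` and
`genL`. -/
theorem isBarSymmetric_expansionMatrix (k : ℕ) {x : ℝ} (hx : Irrational x) (h1 : 1 < x) :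
    IsBarSymmetric (expansionMatrix k x).val := by
  induction k generalizing x with
  | zero => exact isBarSymmetric_one
  | succ k ih =>
    have hg := irrational_gauss hx
    rw [expansionMatrix]
    obtain ⟨a, ha⟩ := Int.eq_ofNat_of_zero_le (zero_le_one.trans (one_le_floor h1))
    obtain ⟨b, hb⟩ := Int.eq_ofNat_of_zero_le (zero_le_one.trans (one_le_floor_gauss hx))
    rw [ha, hb, zpow_natCast, zpow_natCast, Units.val_mul, Units.val_mul, Units.val_pow_eq_pow_val,
      Units.val_pow_eq_pow_val]
    exact ((isBarSymmetric_genR.pow a).mul (isBarSymmetric_genL.pow b)).mul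
      (ih (irrational_gauss hg) (one_lt_gauss hg))

theorem IsBarSymmetric.exists_trace {A : Matrix (Fin 2) (Fin 2) ℤ[T;T⁻¹]} (hA : IsBarSymmetric A) :
    ∃ n : ℤ, A.det = T n ∧ T n * invert A.trace = A.trace := by
  obtain ⟨n, h1, h2⟩ := hA
  refine ⟨n, h1, ?_⟩
  -- This determinant is `q² - q + 1`, equal to `1` at `q = 1` but not a unit. The adjugate
  -- therefore replaces the inverse in the conjugation, and the determinant is cancelled after
  -- taking traces.
  have hdet : barIntertwiner.det ≠ 0 := by
    intro h
    have := congrArg evalOne h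
    simp [barIntertwiner, det_fin_two, evalOne_T] at this
  have h3 := congrArg (fun B => trace (B * barIntertwiner.adjugate)) h2
  have h4 : trace (A.map (invert (R := ℤ))) = invert A.trace := by
    simp [trace_fin_two]
  simp only [smul_mul_assoc, mul_assoc, mul_adjugate, trace_smul, Matrix.mul_smul, mul_one, h4] at h3
  rw [trace_mul_comm, mul_assoc, adjugate_mul, Matrix.mul_smul, mul_one, trace_smul, smul_eq_mul,
    smul_eq_mul, smul_eq_mul, mul_left_comm] at h3
  exact mul_left_cancel₀ hdet h3

/-! ### The matrix fixing a quadratic irrational -/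

theorem lower_left_eq_zero_of_conj {K : Type*} [Field K] {g h : GeneralLinearGroup (Fin 2) K}
    {d : K} (hg : (h * g * h⁻¹).val = d • (1 : Matrix (Fin 2) (Fin 2) K)) : g.val 1 0 = 0 := by
  have h1 : g = h⁻¹ * (h * g * h⁻¹) * h := by group
  rw [h1, Units.val_mul, Units.val_mul, hg, mul_smul_comm, smul_mul_assoc, mul_one,
    ← Units.val_mul, inv_mul_cancel]
  simp

/-- The matrix fixing `[x]_q`, for `x` with `gauss^[2 * (N + k)] x = gauss^[2 * N] x`. -/
noncomputable def fixingMatrix (N k : ℕ) (x : ℝ) : GeneralLinearGroup (Fin 2) ℤ[T;T⁻¹] :=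
  expansionMatrix N x * expansionMatrix k (gauss^[2 * N] x) * (expansionMatrix N x)⁻¹

theorem mulVec_conj_eq_smul {K : Type*} [Field K] {g h : GeneralLinearGroup (Fin 2) K}
    {v w : Fin 2 → K} {c d : K} (hc : c ≠ 0) (hh : h.val *ᵥ w = c • v) (hg : g.val *ᵥ w = d • w) :
    (h * g * h⁻¹).val *ᵥ v = d • v := by
  have h1 : (h⁻¹).val *ᵥ v = c⁻¹ • w := by
    rw [eq_inv_smul_iff₀ hc, ← mulVec_smul, ← hh, mulVec_mulVec, ← Units.val_mul, inv_mul_cancel,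
      Units.val_one, one_mulVec]
  rw [Units.val_mul, Units.val_mul, ← mulVec_mulVec, ← mulVec_mulVec, h1, mulVec_smul, hg,
    mulVec_smul, mulVec_smul, hh, smul_comm d c, inv_smul_smul₀ hc]

variable {N k : ℕ} {x : ℝ}

theorem gauss_iterate_two_mul_eq (h : gauss^[2 * (N + k)] x = gauss^[2 * N] x) :
    gauss^[2 * k] (gauss^[2 * N] x) = gauss^[2 * N] x := by
  rw [← Function.iterate_add_apply, add_comm, ← mul_add, h]

theorem IsRegSeries.fixingMatrix_mulVec {f : ℝ → ℚ⸨X⸩} (hf : IsRegSeries f) (hx : Irrational x)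
    (h : gauss^[2 * (N + k)] x = gauss^[2 * N] x) :
    ∃ c : ℚ⸨X⸩, c ≠ 0 ∧ (GeneralLinearGroup.map laurentToSeries (fixingMatrix N k x)).val *ᵥ
      ![f x, 1] = c • ![f x, 1] := by
  obtain ⟨c, hc, h1⟩ := hf.map_expansionMatrix_mulVec N hx
  obtain ⟨d, hd, h2⟩ := hf.map_expansionMatrix_mulVec k (irrational_gauss_iterate hx (2 * N))
  rw [gauss_iterate_two_mul_eq h] at h2
  refine ⟨d, hd, ?_⟩
  rw [fixingMatrix, map_mul, map_mul, map_inv]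
  exact mulVec_conj_eq_smul hc h1 h2

/-- Otherwise the value at `q = 1` is an upper triangular integer matrix fixing `x`. Unequal
diagonal entries would make `x` rational, so it is scalar. Then the conjugate period matrix is
scalar too, against its positive lower left entry. -/
theorem fixingMatrix_lower_left_ne_zero (hx : Irrational x) (hN : 1 ≤ N) (hk : 1 ≤ k)
    (h : gauss^[2 * (N + k)] x = gauss^[2 * N] x) : (fixingMatrix N k x).val 1 0 ≠ 0 := by
  intro h0
  have hy := irrational_gauss_iterate hx (2 * N)
  obtain ⟨c, hc, h1⟩ := evalOneReal_expansionMatrix_mulVec N hx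
  obtain ⟨d, hd, h2⟩ := evalOneReal_expansionMatrix_mulVec k hy
  rw [gauss_iterate_two_mul_eq h] at h2
  have h3 := mulVec_conj_eq_smul hc h1 h2
  rw [← map_mul, ← map_inv, ← map_mul, ← fixingMatrix] at h3
  have e0 := congrFun h3 0
  have e1 := congrFun h3 1
  simp only [mulVec, dotProduct, Fin.sum_univ_two, GeneralLinearGroup.map_apply, cons_val_zero,
    cons_val_one, Pi.smul_apply, smul_eq_mul, mul_one, evalOneReal_apply, h0, map_zero,
    Int.cast_zero, zero_mul, zero_add] at e0 e1
  have e2 : evalOne ((fixingMatrix N k x).val 0 0) = evalOne ((fixingMatrix N k x).val 1 1) := by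
    by_contra hne
    have hne' : ((evalOne ((fixingMatrix N k x).val 1 1) : ℝ)) -
        evalOne ((fixingMatrix N k x).val 0 0) ≠ 0 :=
      sub_ne_zero.mpr fun h => hne (by exact_mod_cast h.symm)
    refine hx ⟨evalOne ((fixingMatrix N k x).val 0 1) / (evalOne ((fixingMatrix N k x).val 1 1) -
      evalOne ((fixingMatrix N k x).val 0 0)), ?_⟩
    push_cast
    rw [div_eq_iff hne']
    linear_combination e0 - x * e1
  have e3 : ((evalOne ((fixingMatrix N k x).val 0 1) : ℤ) : ℝ) = 0 := by
    rw [e2] at e0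
    linear_combination e0 - x * e1
  have hscalar : (GeneralLinearGroup.map evalOneReal (fixingMatrix N k x)).val =
      d • (1 : Matrix (Fin 2) (Fin 2) ℝ) := by
    ext i j
    fin_cases i <;> fin_cases j <;>
      simp [evalOneReal_apply, h0, e1, e2, e3]
  rw [fixingMatrix, map_mul, map_mul, map_inv] at hscalar
  have h4 := lower_left_eq_zero_of_conj hscalar
  obtain ⟨k, rfl⟩ := Nat.exists_eq_add_of_le' hk
  obtain ⟨p, r, -, hr, h5⟩ := evalOneReal_expansionMatrix_pos k hy
    (one_lt_gauss_iterate hx (by omega))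
  have h6 := congrFun h5 1
  simp only [mulVec, dotProduct, Fin.sum_univ_two, cons_val_zero, cons_val_one, h4, zero_mul,
    mul_zero, add_zero] at h6
  exact hr.ne h6

/-- Trace and determinant ignore conjugation by the preperiod, whose first digit may be negative;
only the period matrix, with positive digits, matters. -/
theorem fixingMatrix_exists_trace (hx : Irrational x) (hN : 1 ≤ N) :
    ∃ n : ℤ, (fixingMatrix N k x).val.det = T n ∧
      T n * invert (fixingMatrix N k x).val.trace = (fixingMatrix N k x).val.trace := by
  have h1 := (isBarSymmetric_expansionMatrix k (irrational_gauss_iterate hx (2 * N))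
    (one_lt_gauss_iterate hx (by omega))).exists_trace
  have h2 : (fixingMatrix N k x).val.trace = (expansionMatrix k (gauss^[2 * N] x)).val.trace :=
    trace_units_conj _ _
  have h3 : (fixingMatrix N k x).val.det = (expansionMatrix k (gauss^[2 * N] x)).val.det :=
    det_units_conj _ _
  rwa [h2, h3]

/-! ### Clearing denominators -/

theorem exists_toLaurent_eq_mul_T {ι : Type*} [Fintype ι] (p : ι → ℤ[T;T⁻¹]) :
    ∃ (m : ℕ) (g : ι → ℤ[X]), ∀ i, toLaurent (g i) = p i * T m := by
  choose n g hg using fun i => exists_T_pow (p i)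
  refine ⟨∑ i, n i, fun i => g i * X ^ (∑ j, n j - n i), fun i => ?_⟩
  have : n i ≤ ∑ j, n j := Finset.single_le_sum (fun _ _ => Nat.zero_le _) (Finset.mem_univ i)
  rw [map_mul, toLaurent_X_pow, hg, mul_assoc, ← T_add]
  congr 2
  omega

theorem polyToSeries_X : polyToSeries X = qVar :=
  Polynomial.aeval_X qVar

theorem laurentToSeries_toLaurent (p : ℤ[X]) : laurentToSeries (toLaurent p) = polyToSeries p := by
  have : laurentToSeries.comp toLaurent = polyToSeries := by
    refine Polynomial.ringHom_ext' (RingHom.ext_int _ _) ?_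
    rw [RingHom.comp_apply, toLaurent_X, laurentToSeries_T, zpow_one, polyToSeries_X]
  exact DFunLike.congr_fun this p

theorem polyToSeries_injective : Function.Injective polyToSeries := by
  rw [injective_iff_map_eq_zero]
  intro p hp
  have h : polyToSeries p = ofIntSeries (p : PowerSeries ℤ) := by
    have : polyToSeries = ofIntSeries.comp (Polynomial.coeToPowerSeries.ringHom (R := ℤ)) := by
      refine Polynomial.ringHom_ext' (RingHom.ext_int _ _) ?_
      rw [polyToSeries_X, RingHom.comp_apply, ← ofIntSeries_X]
      simp
    rw [this]
    rfl
  rw [h] at hp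
  ext n
  have := coeff_ofIntSeries_natCast (p : PowerSeries ℤ) n
  rw [hp] at this
  simpa using this.symm

theorem discr_isPalindrome {a b c d : ℤ[T;T⁻¹]} {A B C D : ℤ[X]} {m : ℕ} {n : ℤ}
    (hA : toLaurent A = a * T m) (hB : toLaurent B = b * T m) (hC : toLaurent C = c * T m)
    (hD : toLaurent D = d * T m) (hdet : a * d - b * c = T n)
    (htr : T n * invert (a + d) = a + d) :
    IsPalindrome ((A + D) ^ 2 - 4 * (A * D - B * C)) := by
  have h : toLaurent ((A + D) ^ 2 - 4 * (A * D - B * C)) =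
      ((a + d) ^ 2 - 4 * T n) * T m ^ 2 := by
    simp only [map_sub, map_mul, map_pow, map_add, hA, hB, hC, hD, ← hdet, map_ofNat]
    ring
  -- Both `tr²` and `4 det` pick up `q^(2n)` under the symmetry; the clearing factor `q^(2m)`
  -- contributes `q^(4m)`.
  refine ⟨2 * n + 4 * m, ?_⟩
  rw [h]
  simp only [map_sub, map_mul, map_pow, invert_T, map_ofNat]
  have e1 : (T (2 * n + 4 * m) : ℤ[T;T⁻¹]) = T n * T n * T m ^ 2 * T m ^ 2 := by
    simp only [T_pow, ← T_add]
    congr 1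
    push_cast
    ring
  have e2 : (T n * T (-n) : ℤ[T;T⁻¹]) = 1 := by rw [← T_add, add_neg_cancel, T_zero]
  have e3 : (T m * T (-m) : ℤ[T;T⁻¹]) = 1 := by rw [← T_add, add_neg_cancel, T_zero]
  rw [e1]
  nth_rewrite 1 [← htr]
  generalize invert (a + d) = s at *
  have e4 : (T (-(m : ℤ)) : ℤ[T;T⁻¹]) ^ 2 * T m ^ 2 = 1 := by
    rw [← mul_pow, mul_comm, e3, one_pow]
  calc _ = T n * (T n * s ^ 2 - 4) * T m ^ 2 := by ring
    _ = T n * (T n * s ^ 2 - 4 * (T n * T (-n))) * T m ^ 2 * (T (-(m : ℤ)) ^ 2 * T m ^ 2) := by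
      rw [e2, e4, mul_one, mul_one]
    _ = _ := by ring

/-- The series fixed by the matrix with entries `A, B, C, D` are quadratic irrationals over the
field of fractions of `ℤ[q]`. -/
theorem quadratic_of_fixed {K : Type*} [Field K] {F A B C D c : K} (hC : 2 * C ≠ 0)
    (h0 : A * F + B = c * F) (h1 : C * F + D = c) :
    C * F ^ 2 + (D - A) * F + -B = 0 ∧
      (2 * C * F - (A - D)) ^ 2 = (A + D) ^ 2 - 4 * (A * D - B * C) ∧
      F = ((A - D) + (2 * C * F - (A - D))) / (2 * C) := by
  have h : C * F ^ 2 + (D - A) * F + -B = 0 := by linear_combination F * h1 - h0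
  refine ⟨h, by linear_combination 4 * C * h, ?_⟩
  rw [add_sub_cancel, mul_div_cancel_left₀ _ hC]

end QDeformed

/-! ### The main theorem -/

open Polynomial LaurentPolynomial LaurentSeries QDeformed in
/-- The conclusion starts with the fact that the series `[x]_q` is well defined. -/
theorem theorem1p2 (x : ℝ) (hx : IsQuadraticIrrational x) :
    IsQDeformation x (qReal x) ∧
    (∃ (R P S : ℤ[X]) (D : ℚ⸨X⸩), S ≠ 0 ∧ IsPalindrome P ∧ D ^ 2 = polyToSeries P ∧
      (qReal x = (polyToSeries R + D) / polyToSeries S ∨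
        qReal x = (polyToSeries R - D) / polyToSeries S)) ∧
    (∃ A B C : ℤ[X], A ≠ 0 ∧
      polyToSeries A * qReal x ^ 2 + polyToSeries B * qReal x + polyToSeries C = 0) ∧
    (∃ M : Matrix.GeneralLinearGroup (Fin 2) ℤ[T;T⁻¹],
      (∀ u : ℤ[T;T⁻¹], M.val ≠ Matrix.scalar (Fin 2) u) ∧ MoebiusFixes M (qReal x)) ∧
    (HasPeriodicRegExpansion x (qReal x) ∧ HasPeriodicNegExpansion x (qReal x)) := by
  obtain ⟨f, hf⟩ := exists_isRegSeries
  have hi := hx.irrational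
  rw [hf.qReal_eq hi]
  obtain ⟨N, k, hN, hk, hper⟩ := hx.exists_iterate_gauss_eq
  -- The matrices consume digits in pairs, so preperiod and period are doubled.
  have hper2 : gauss^[2 * (N + k)] x = gauss^[2 * N] x := by
    rw [show 2 * (N + k) = 2 * N + k + k by ring, iterate_add_eq_of_le hper (by omega),
      iterate_add_eq_of_le hper (by omega)]
  set M := fixingMatrix N k x with hM
  have hC : M.val 1 0 ≠ 0 := fixingMatrix_lower_left_ne_zero hi hN hk hper2
  obtain ⟨n, hdet, htr⟩ := fixingMatrix_exists_trace (k := k) hi hN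
  rw [← hM, Matrix.det_fin_two] at hdet
  rw [← hM, Matrix.trace_fin_two] at htr
  obtain ⟨c, hc, hfix⟩ := hf.fixingMatrix_mulVec hi hper2
  have e0 := congrFun hfix 0
  have e1 := congrFun hfix 1
  simp only [Matrix.mulVec, dotProduct, Fin.sum_univ_two, Matrix.GeneralLinearGroup.map_apply,
    Matrix.cons_val_zero, Matrix.cons_val_one, Pi.smul_apply, smul_eq_mul, mul_one, ← hM] at e0 e1
  obtain ⟨m, g, hg⟩ := exists_toLaurent_eq_mul_T fun p : Fin 2 × Fin 2 => M.val p.1 p.2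
  have hs : ∀ i j, polyToSeries (g (i, j)) = laurentToSeries (M.val i j) * qVar ^ m := by
    intro i j
    rw [← laurentToSeries_toLaurent, hg, map_mul, laurentToSeries_T, zpow_natCast]
  have hC' : g (1, 0) ≠ 0 := by
    rw [← Polynomial.toLaurent_ne_zero, hg]
    exact mul_ne_zero hC (isUnit_T _).ne_zero
  have h2C : (2 : ℤ[X]) * g (1, 0) ≠ 0 := mul_ne_zero two_ne_zero hC'
  have h2C' : 2 * polyToSeries (g (1, 0)) ≠ 0 := by
    have := (map_ne_zero_iff polyToSeries polyToSeries_injective).mpr h2C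
    rwa [map_mul, map_ofNat] at this
  obtain ⟨hq, hsq, hsol⟩ := quadratic_of_fixed (F := f x) (A := polyToSeries (g (0, 0)))
    (B := polyToSeries (g (0, 1))) (D := polyToSeries (g (1, 1))) (c := c * qVar ^ m) h2C'
    (by rw [hs, hs]; linear_combination qVar ^ m * e0)
    (by rw [hs, hs]; linear_combination qVar ^ m * e1)
  -- The square root is taken to be `2C[x]_q - (A - D)`, whose square is the discriminant, so the
  -- sign `+` always serves.
  refine ⟨hf.isQDeformation hi, ⟨g (0, 0) - g (1, 1), _, 2 * g (1, 0),
    2 * polyToSeries (g (1, 0)) * f x - (polyToSeries (g (0, 0)) - polyToSeries (g (1, 1))), h2C,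
    discr_isPalindrome (hg (0, 0)) (hg (0, 1)) (hg (1, 0)) (hg (1, 1)) hdet htr, ?_,
    Or.inl ?_⟩, ⟨g (1, 0), g (1, 1) - g (0, 0), -g (0, 1), hC', ?_⟩, ⟨M, fun u hu => hC ?_, ?_, ?_⟩,
    hf.hasPeriodicRegExpansion hx, hf.hasPeriodicNegExpansion hx⟩
  · rw [hsq]
    simp only [map_sub, map_mul, map_pow, map_add, map_ofNat]
  · rw [map_sub, map_mul, map_ofNat]
    exact hsol
  · rw [map_sub, map_neg]
    exact hq
  · rw [hu]
    simp
  · rw [e1]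
    exact hc
  · rw [e1, e0, mul_div_cancel_left₀ _ hc]
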